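/- **Model.** Let $n,k,w\ge 1$ be integers. In the cell-probe model with word size $w$, a memory is a collection of cells with $w$-bit addresses, each holding a $w$-bit word. The *Multiphase problem* has three phases. Phase I: sets $\vec S=(S_1,\dots,S_k)$, $S_i\subseteq[n]$, are given and preprocessed into a memory $\mathcal M=\mathcal M(\vec S)$. Phase II: a set $T\subseteq[n]$ is given and the memory is updated; the update is general, i.e. the set $\Delta=\Delta(\mathcal M,T)$ of cells that it writes and their new contents may depend arbitrarily on $\mathcal M$ and $T$. Phase III: an index $i\in[k]$ is given and the data structure must decide whether $S_i\cap T=\emptyset$. A (deterministic, zero-error) data structure for this problem is *semi-adaptive* with *query time* $t_q=t_1+t_2$ if its query algorithm, given $i$, reads $S_i$ free of charge, then adaptively probes at most $t_1$ cells of the memory $\mathcal M$ (with their contents before the update), and then adaptively makes at most $t_2$ probes to the updated cells, where the probe of a cell returns its new content if the cell belongs to $\Delta$ and a special symbol $\perp$ otherwise, and answers. It has *update time* $t_u$ if Phase II always writes at most $n\cdot t_u$ cells, i.e. $|\Delta(\mathcal M(\vec S),T)|\le n\cdot t_u$ for all $\vec S,T$ (reads made by the update are not even charged). **Theorem.** There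 is an absolute constant $c>0$ such that the following holds. Let $k=k(n)$ satisfy $k=\omega(n)$. Then for all sufficiently large $n$ (depending only on the function $k$) and every word size $w\ge1$, every semi-adaptive data structure in the cell-probe model with word size $w$ that solves the Multiphase problem with $k=k(n)$ subsets of $[n]$, with update time $t_u$ and query time $t_q$, satisfies $$ n\cdot t_u\ \ge\ c\cdot\frac{k}{w}\qquad\text{or}\qquad t_q\ \ge\ c\cdot\frac{\sqrt n}{w}. $$ -/

import Mathlib

open Filter Asymptotics

/-- A deterministic adaptive probing algorithm (a decision tree): either it stops with an output
`o : O`, or it probes an address `a : A` and continues depending on the reply in `R`. -/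
inductive ProbeAlg (A R O : Type) : Type where
  | done (o : O) : ProbeAlg A R O
  | probe (a : A) (next : R → ProbeAlg A R O) : ProbeAlg A R O

namespace ProbeAlg

/-- The output, when a probe of address `a` is answered by `reply a`. -/
def output {A R O : Type} (reply : A → R) : ProbeAlg A R O → O
  | done o => o
  | probe a next => (next (reply a)).output reply

/-- The number of probes made, when a probe of address `a` is answered by `reply a`. -/
def numProbes {A R O : Type} (reply : A → R) : ProbeAlg A R O → ℕ
  | done _ => 0
  | probe a next => (next (reply a)).numProbes reply + 1

end ProbeAlg

/-- A memory state in the cell-probe model with word size `w`: the cells are addressed by `w`-bit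
words, and each cell stores a `w`-bit word. -/
abbrev CellMemory (w : ℕ) : Type := BitVec w → BitVec w

/-- A semi-adaptive dynamic data structure, in the cell-probe model with word size `w`, for `k`
subsets `S i` (`i : Fin k`) of the `n`-element universe `Fin n`. It is a structure of algorithms
only; correctness and running times are the predicates below. -/
structure SemiAdaptiveDS (n k w : ℕ) where
  /-- Phase I: the memory after preprocessing the sets `S`. -/
  preprocess : (Fin k → Finset (Fin n)) → CellMemory w
  /-- Phase II: the set `Δ` of the cells that the update with the set `T` writes, which may depend
  arbitrarily (in particular adaptively) on the old memory and on `T`. -/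
  updated : CellMemory w → Finset (Fin n) → Finset (BitVec w)
  /-- Phase II: the memory after the update with the set `T`. -/
  newMemory : CellMemory w → Finset (Fin n) → CellMemory w
  /-- Only the cells of `Δ` are changed. -/
  newMemory_eq_of_notMem : ∀ (M : CellMemory w) (T : Finset (Fin n)) (a : BitVec w),
    a ∉ updated M T → newMemory M T a = M a
  /-- Phase III: the query algorithm. It is given the index `i` and, for free, the set `S i`.
  It first probes cells of the preprocessed memory; the output of this first layer is an algorithm
  that probes the updated cells and outputs a Boolean answer. In the second layer the reply to
  the probe of a cell is `none` if the cell was not updated, and otherwise its new content. -/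
  query : Fin k → Finset (Fin n) →
    ProbeAlg (BitVec w) (BitVec w) (ProbeAlg (BitVec w) (Option (BitVec w)) Bool)

namespace SemiAdaptiveDS

variable {n k w : ℕ}

/-- The reply to a probe in the second layer of the query, when the memory was `M` before the
update with `T`. -/
def deltaReply (D : SemiAdaptiveDS n k w) (M : CellMemory w) (T : Finset (Fin n))
    (a : BitVec w) : Option (BitVec w) :=
  if a ∈ D.updated M T then some (D.newMemory M T a) else none

/-- The second layer of the query algorithm with index `i`, as selected by the outcome of the
first layer, which probes the memory after preprocessing `S`. -/
def secondLayer (D : SemiAdaptiveDS n k w) (S : Fin k → Finset (Fin n)) (i : Fin k) :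
    ProbeAlg (BitVec w) (Option (BitVec w)) Bool :=
  (D.query i (S i)).output (D.preprocess S)

/-- The answer to the query `i` after preprocessing `S` and updating with `T`. -/
def answer (D : SemiAdaptiveDS n k w) (S : Fin k → Finset (Fin n)) (T : Finset (Fin n))
    (i : Fin k) : Bool :=
  (D.secondLayer S i).output (D.deltaReply (D.preprocess S) T)

/-- `D` solves the Multiphase problem: on all inputs it decides whether `S i ∩ T = ∅`. -/
def SolvesMultiphase (D : SemiAdaptiveDS n k w) : Prop :=
  ∀ (S : Fin k → Finset (Fin n)) (T : Finset (Fin n)) (i : Fin k),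
    D.answer S T i = true ↔ S i ∩ T = ∅

/-- `D` has update time at most `tu`: the whole of Phase II always writes at most `n * tu` cells. -/
def UpdateTimeLE (D : SemiAdaptiveDS n k w) (tu : ℝ) : Prop :=
  ∀ (S : Fin k → Finset (Fin n)) (T : Finset (Fin n)),
    ((D.updated (D.preprocess S) T).card : ℝ) ≤ n * tu

/-- The query algorithm of `D` always makes at most `t₁` probes to the preprocessed memory, and
then at most `t₂` probes to the updated cells. -/
def QueryTimeLE (D : SemiAdaptiveDS n k w) (t₁ t₂ : ℕ) : Prop :=
  ∀ (S : Fin k → Finset (Fin n)) (T : Finset (Fin n)) (i : Fin k),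
    (D.query i (S i)).numProbes (D.preprocess S) ≤ t₁ ∧
    (D.secondLayer S i).numProbes (D.deltaReply (D.preprocess S) T) ≤ t₂

end SemiAdaptiveDS

-- Restrict to sets that pick one element from each of `q = Nat.sqrt n` blocks of size `q`, and draw
-- all `S i` and `q` independent updates `T j` uniformly. If few cells are written, the update
-- messages `ρ S (T j)` have few possible values, so some `S i` has small mutual information with
-- all pairs `Y j = (T j, ρ S (T j))` (`sum_information_le`). The replies of the first probing layer
-- are short advice about `S`; adding them costs little. By the chain rule (`exists_prefix`) there
-- is a `j` such that, with `Z` the advice and the earlier pairs, `S i` is almost independent of `Y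
-- j` given `Z`, while `Z` says little about `S i`.
--
-- Now resample `S i` and `Y j` independently given `Z`. The query becomes a short two-party
-- protocol for block disjointness whose error is at most the conditional information
-- (`sum_markov_le`). A transcript restricts the side of `Y j` to a set independent of `S i`. By
-- corruption (`card_mostly_disjoint_le`), for very few `S i` can such a set, if heavy, consist
-- mostly of disjoint pairs, and the small information in `Z` keeps these `S i` unlikely
-- (`mul_sum_law_le`). For every other `S i` the error is bounded below by a constant, although
-- disjoint pairs have constant probability. `false_of_protocol` assembles the contradiction.

namespace FiniteEntropy

-- Entropy on finite uniform spaces.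

open Finset Real

variable {Ω α β γ : Type*} [Fintype Ω]

/-- The average of `f` over a finite type. -/
noncomputable def avg (f : Ω → ℝ) : ℝ := (∑ ω, f ω) / Fintype.card Ω

open Classical in
/-- The law of `X` under the uniform distribution. -/
noncomputable def law (X : Ω → α) (a : α) : ℝ := avg fun ω => if X ω = a then 1 else 0

/-- The Shannon entropy (in nats) of `X` under the uniform distribution. -/
noncomputable def entropy (X : Ω → α) : ℝ := -avg fun ω => log (law X (X ω))

lemma avg_mono {f g : Ω → ℝ} (h : ∀ ω, f ω ≤ g ω) : avg f ≤ avg g := by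
  unfold avg
  gcongr with ω
  exact h ω

lemma avg_add (f g : Ω → ℝ) : avg (fun ω => f ω + g ω) = avg f + avg g := by
  simp [avg, sum_add_distrib, add_div]

lemma avg_sub (f g : Ω → ℝ) : avg (fun ω => f ω - g ω) = avg f - avg g := by
  simp [avg, sum_sub_distrib, sub_div]

lemma avg_sum {ι : Type*} (s : Finset ι) (f : ι → Ω → ℝ) :
    avg (fun ω => ∑ i ∈ s, f i ω) = ∑ i ∈ s, avg (f i) := by
  simp only [avg, sum_div]
  rw [sum_comm]

lemma avg_const_mul (c : ℝ) (f : Ω → ℝ) : avg (fun ω => c * f ω) = c * avg f := by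
  simp [avg, ← mul_sum, mul_div_assoc]

lemma avg_const [Nonempty Ω] (c : ℝ) : avg (fun _ : Ω => c) = c := by
  simp [avg]

lemma law_nonneg (X : Ω → α) (a : α) : 0 ≤ law X a := by
  unfold law avg
  positivity

lemma law_pos [Nonempty Ω] (X : Ω → α) (ω : Ω) : 0 < law X (X ω) := by
  classical
  unfold law avg
  have h : (1 : ℝ) ≤ ∑ ω', if X ω' = X ω then (1 : ℝ) else 0 := by
    have := single_le_sum (f := fun ω' => if X ω' = X ω then (1 : ℝ) else 0)
      (fun i _ => by positivity) (mem_univ ω)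
    simpa using this
  positivity

lemma law_le_of_imp {X : Ω → α} {Y : Ω → β} {a : α} {b : β} (h : ∀ ω, X ω = a → Y ω = b) :
    law X a ≤ law Y b := by
  classical
  unfold law
  refine avg_mono fun ω => ?_
  by_cases hX : X ω = a
  · simp [hX, h ω hX]
  · simp only [hX, if_false]
    positivity

lemma avg_comp [Fintype α] (X : Ω → α) (f : α → ℝ) :
    avg (fun ω => f (X ω)) = ∑ a, law X a * f a := by
  classical
  simp only [law, mul_comm _ (f _), ← avg_const_mul, ← avg_sum]
  simp

lemma sum_law [Nonempty Ω] [Fintype α] (X : Ω → α) : ∑ a, law X a = 1 := by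
  have := avg_comp X (fun _ => 1)
  simpa [avg_const] using this.symm

lemma sum_law_pair_right [Fintype β] (X : Ω → α) (Y : Ω → β) (a : α) :
    ∑ b, law (fun ω => (X ω, Y ω)) (a, b) = law X a := by
  classical
  simp only [law, ← avg_sum, Prod.mk.injEq]
  congr 1
  ext ω
  by_cases h : X ω = a <;> simp [h]

lemma sum_law_pair_left [Fintype α] (X : Ω → α) (Y : Ω → β) (b : β) :
    ∑ a, law (fun ω => (X ω, Y ω)) (a, b) = law Y b := by
  classical
  simp only [law, ← avg_sum, Prod.mk.injEq]
  congr 1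
  ext ω
  by_cases h : Y ω = b <;> simp [h]

lemma entropy_mono [Nonempty Ω] {X : Ω → α} {Y : Ω → β}
    (h : ∀ ω ω', Y ω = Y ω' → X ω = X ω') : entropy X ≤ entropy Y := by
  unfold entropy
  refine neg_le_neg (avg_mono fun ω => ?_)
  exact log_le_log (law_pos Y ω) (law_le_of_imp fun ω' => h ω' ω)

lemma entropy_congr [Nonempty Ω] {X : Ω → α} {Y : Ω → β}
    (h : ∀ ω ω', X ω = X ω' ↔ Y ω = Y ω') : entropy X = entropy Y :=
  le_antisymm (entropy_mono fun ω ω' => (h ω ω').2) (entropy_mono fun ω ω' => (h ω ω').1)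

/-- Gibbs' inequality. -/
lemma avg_log_add_entropy_le [Nonempty Ω] [Fintype α] (W : Ω → α) {g : α → ℝ}
    (hg : ∀ a, 0 ≤ g a) (hpos : ∀ ω, 0 < g (W ω)) :
    avg (fun ω => log (g (W ω))) + entropy W ≤ log (∑ a, g a) := by
  classical
  obtain ⟨ω₀⟩ := ‹Nonempty Ω›
  have hG : 0 < ∑ a, g a :=
    (hpos ω₀).trans_le (single_le_sum (fun a _ => hg a) (mem_univ (W ω₀)))
  set G := ∑ a, g a with hGdef
  have : Nonempty Ω := ⟨ω₀⟩
  have key : ∀ ω, log (g (W ω)) - log (law W (W ω)) - log G ≤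
      g (W ω) / law W (W ω) / G - 1 := fun ω => by
    have h1 := hpos ω
    have h2 := law_pos W ω
    rw [← log_div h1.ne' h2.ne', ← log_div (by positivity) hG.ne']
    exact log_le_sub_one_of_pos (by positivity)
  have h1 := avg_mono key
  have h2 : avg (fun ω => g (W ω) / law W (W ω) / G) ≤ 1 := by
    rw [avg_comp W (fun a => g a / law W a / G)]
    calc ∑ a, law W a * (g a / law W a / G) ≤ ∑ a, g a / G := by
          refine sum_le_sum fun a _ => ?_
          rcases (law_nonneg W a).eq_or_lt with h | h
          · rw [← h, zero_mul]
            exact div_nonneg (hg a) hG.le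
          · apply le_of_eq
            field_simp
      _ = 1 := by rw [← sum_div, div_self hG.ne']
  simp only [avg_sub, avg_const] at h1
  simp only [entropy]
  linarith

lemma entropy_le_log_card [Nonempty Ω] [Fintype α] (X : Ω → α) :
    entropy X ≤ log (Fintype.card α) := by
  have := avg_log_add_entropy_le X (g := fun _ => 1) (fun _ => zero_le_one) (fun _ => one_pos)
  simpa [avg_const] using this

lemma entropy_eq_log_card [Nonempty Ω] (X : Ω → α) (hX : Function.Injective X) :
    entropy X = log (Fintype.card Ω) := by
  classical
  have h : ∀ ω, law X (X ω) = 1 / Fintype.card Ω := fun ω => by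
    simp [law, avg, hX.eq_iff]
  simp [entropy, h, avg_const]

lemma entropy_of_law_eq [Nonempty Ω] (X : Ω → α) (c : ℝ) (h : ∀ a, law X a = c) :
    entropy X = -log c := by
  simp [entropy, h, avg_const]

lemma entropy_pair_le [Nonempty Ω] [Fintype α] [Fintype β] (X : Ω → α) (Y : Ω → β) :
    entropy (fun ω => (X ω, Y ω)) ≤ entropy X + entropy Y := by
  have h := avg_log_add_entropy_le (fun ω => (X ω, Y ω)) (g := fun p => law X p.1 * law Y p.2)
    (fun p => mul_nonneg (law_nonneg _ _) (law_nonneg _ _))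
    (fun ω => mul_pos (law_pos X ω) (law_pos Y ω))
  rw [Fintype.sum_prod_type] at h
  simp only [← mul_sum, sum_law, mul_one, log_one] at h
  have h2 : avg (fun ω => log (law X (X ω) * law Y (Y ω))) = -entropy X - entropy Y := by
    simp only [entropy, log_mul (law_pos X _).ne' (law_pos Y _).ne', avg_add]
    ring
  rw [h2] at h
  linarith

/-- Conditional subadditivity of entropy. -/
lemma entropy_pi_pair_le [Nonempty Ω] {ι : Type*} [Fintype ι] [Fintype α] [Fintype β]
    (S : Ω → ι → α) (Y : Ω → β) :
    entropy (fun ω => (S ω, Y ω)) ≤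
      entropy Y + ∑ i, (entropy (fun ω => (S ω i, Y ω)) - entropy Y) := by
  classical
  -- The comparison measure keeps the law of `Y` and makes the coordinates of `S` conditionally
  -- independent given `Y`.
  have h := avg_log_add_entropy_le (fun ω => (Y ω, S ω))
    (g := fun p => law Y p.1 *
      ∏ i, (law (fun ω => (S ω i, Y ω)) (p.2 i, p.1) / law Y p.1))
    (fun p => mul_nonneg (law_nonneg _ _)
      (prod_nonneg fun i _ => div_nonneg (law_nonneg _ _) (law_nonneg _ _)))
    (fun ω => mul_pos (law_pos Y ω) (prod_pos fun i _ =>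
      div_pos (law_pos (fun ω => (S ω i, Y ω)) ω) (law_pos Y ω)))
  have hsum : ∑ p : β × (ι → α), law Y p.1 *
      ∏ i, (law (fun ω => (S ω i, Y ω)) (p.2 i, p.1) / law Y p.1) = 1 := by
    rw [Fintype.sum_prod_type]
    simp only [← mul_sum]
    rw [← sum_law Y]
    refine sum_congr rfl fun y _ => ?_
    rcases (law_nonneg Y y).eq_or_lt with h0 | h0
    · rw [← h0, zero_mul]
    · rw [← Fintype.prod_sum (fun i a => law (fun ω => (S ω i, Y ω)) (a, y) / law Y y)]
      simp only [← sum_div, sum_law_pair_left, div_self h0.ne', prod_const_one, mul_one]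
  rw [hsum, log_one] at h
  have h2 : avg (fun ω => log (law Y (Y ω) *
      ∏ i, (law (fun ω => (S ω i, Y ω)) (S ω i, Y ω) / law Y (Y ω)))) =
      -(entropy Y + ∑ i, (entropy (fun ω => (S ω i, Y ω)) - entropy Y)) := by
    have h3 : ∀ ω, log (law Y (Y ω) *
        ∏ i, (law (fun ω => (S ω i, Y ω)) (S ω i, Y ω) / law Y (Y ω))) =
        log (law Y (Y ω)) + ∑ i, (log (law (fun ω => (S ω i, Y ω)) (S ω i, Y ω)) -
          log (law Y (Y ω))) := fun ω => by
      have hp : ∀ i, 0 < law (fun ω => (S ω i, Y ω)) (S ω i, Y ω) :=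
        fun i => law_pos (fun ω => (S ω i, Y ω)) ω
      have hY := law_pos Y ω
      rw [log_mul hY.ne' (prod_pos fun i _ => div_pos (hp i) hY).ne',
        log_prod fun i _ => (div_pos (hp i) hY).ne']
      simp only [log_div (hp _).ne' hY.ne']
    simp only [h3, avg_add, avg_sum, avg_sub, entropy]
    rw [neg_add, neg_neg, ← sum_neg_distrib]
    congr 1
    refine sum_congr rfl fun i _ => ?_
    ring
  rw [h2] at h
  have h4 : entropy (fun ω => (S ω, Y ω)) = entropy (fun ω => (Y ω, S ω)) :=
    entropy_congr fun ω ω' => by simp [and_comm]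
  rw [h4]
  linarith

open Classical in
/-- An event that is unlikely under the product of the marginals is unlikely for a pair of small
mutual information. -/
lemma mul_sum_law_le [Nonempty Ω] [Fintype α] [Fintype γ] (X : Ω → α) (Z : Ω → γ)
    (B : α → γ → Prop) {c δ : ℝ}
    (h : ∀ z, (∑ x, law X x * if B x z then 1 else 0) ≤ δ) :
    c * (∑ x, ∑ z, law (fun ω => (X ω, Z ω)) (x, z) * if B x z then 1 else 0) ≤
      entropy X + entropy Z - entropy (fun ω => (X ω, Z ω)) + log (1 + exp c * δ) := by
  -- Donsker–Varadhan: the product of the marginals is tilted by `exp c` on the event.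
  have hG := avg_log_add_entropy_le (fun ω => (X ω, Z ω))
    (g := fun p => law X p.1 * law Z p.2 * exp (c * if B p.1 p.2 then 1 else 0))
    (fun p => mul_nonneg (mul_nonneg (law_nonneg _ _) (law_nonneg _ _)) (exp_pos _).le)
    (fun ω => mul_pos (mul_pos (law_pos X ω) (law_pos Z ω)) (exp_pos _))
  have h1 : avg (fun ω => log (law X (X ω) * law Z (Z ω) *
      exp (c * if B (X ω) (Z ω) then 1 else 0))) = -entropy X - entropy Z +
      c * (∑ x, ∑ z, law (fun ω => (X ω, Z ω)) (x, z) * if B x z then 1 else 0) := by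
    have h3 : ∀ ω, log (law X (X ω) * law Z (Z ω) *
        exp (c * if B (X ω) (Z ω) then 1 else 0)) =
        log (law X (X ω)) + log (law Z (Z ω)) + c * if B (X ω) (Z ω) then 1 else 0 :=
      fun ω => by
        rw [log_mul (mul_pos (law_pos X ω) (law_pos Z ω)).ne' (exp_pos _).ne',
          log_mul (law_pos X ω).ne' (law_pos Z ω).ne', log_exp]
    simp only [h3, avg_add, entropy, avg_const_mul]
    rw [avg_comp (fun ω => (X ω, Z ω)) (fun p => if B p.1 p.2 then 1 else 0),
      Fintype.sum_prod_type]
    ring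
  have h2 : ∑ p : α × γ, law X p.1 * law Z p.2 * exp (c * if B p.1 p.2 then 1 else 0) ≤
      1 + exp c * δ := by
    calc ∑ p : α × γ, law X p.1 * law Z p.2 * exp (c * if B p.1 p.2 then 1 else 0)
        ≤ ∑ p : α × γ, (law X p.1 * law Z p.2 +
            exp c * (law Z p.2 * (law X p.1 * if B p.1 p.2 then 1 else 0))) := by
          refine sum_le_sum fun p _ => ?_
          have hX := law_nonneg X p.1
          have hZ := law_nonneg Z p.2
          split_ifs
          · have := mul_nonneg hX hZ
            rw [mul_one]
            linarith
          · simp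
      _ = 1 + exp c * ∑ z, law Z z * ∑ x, law X x * if B x z then 1 else 0 := by
          rw [Fintype.sum_prod_type_right]
          simp only [sum_add_distrib, ← mul_sum, ← sum_mul, sum_law, one_mul]
      _ ≤ 1 + exp c * ∑ z, law Z z * δ := by
          gcongr with z
          · exact law_nonneg _ _
          · exact h z
      _ = 1 + exp c * δ := by rw [← sum_mul, sum_law, one_mul]
  have h3 : 0 < ∑ p : α × γ, law X p.1 * law Z p.2 * exp (c * if B p.1 p.2 then 1 else 0) := by
    obtain ⟨ω₀⟩ := ‹Nonempty Ω›
    have : Nonempty Ω := ⟨ω₀⟩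
    refine lt_of_lt_of_le ?_ (single_le_sum (fun p _ => ?_) (mem_univ (X ω₀, Z ω₀)))
    · exact mul_pos (mul_pos (law_pos X ω₀) (law_pos Z ω₀)) (exp_pos _)
    · exact mul_nonneg (mul_nonneg (law_nonneg _ _) (law_nonneg _ _)) (exp_pos _).le
  have h4 := log_le_log h3 h2
  rw [h1] at hG
  linarith

open Classical in
/-- If an event never happens for `(X, Z, Y)`, then its probability when `X` and `Y` are made
conditionally independent given `Z` is at most the conditional mutual information. -/
lemma sum_markov_le [Nonempty Ω] [Fintype α] [Fintype β] [Fintype γ] (X : Ω → α) (Y : Ω → β)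
    (Z : Ω → γ) (B : α → γ → β → Prop) (h : ∀ ω, ¬ B (X ω) (Z ω) (Y ω)) :
    (∑ x, ∑ z, law (fun ω => (X ω, Z ω)) (x, z) *
      ∑ y, law (fun ω => (Y ω, Z ω)) (y, z) / law Z z * if B x z y then 1 else 0) ≤
      entropy (fun ω => (X ω, Z ω)) + entropy (fun ω => (Y ω, Z ω)) -
        entropy (fun ω => (X ω, Y ω, Z ω)) - entropy Z := by
  set ν : α × γ × β → ℝ := fun p => law (fun ω => (X ω, Z ω)) (p.1, p.2.1) *
    (law (fun ω => (Y ω, Z ω)) (p.2.2, p.2.1) / law Z p.2.1) with hν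
  have hν0 : ∀ p, 0 ≤ ν p := fun p =>
    mul_nonneg (law_nonneg _ _) (div_nonneg (law_nonneg _ _) (law_nonneg _ _))
  have hνpos : ∀ ω, 0 < ν (X ω, Z ω, Y ω) := fun ω =>
    mul_pos (law_pos (fun ω => (X ω, Z ω)) ω)
      (div_pos (law_pos (fun ω => (Y ω, Z ω)) ω) (law_pos Z ω))
  -- The true triple avoids `B`, so the Markov measure `ν` may be cut down to the complement of `B`.
  -- Its mass drops to `1 - ν(B)`, and `log (1 - x) ≤ -x`.
  have hG := avg_log_add_entropy_le (fun ω => (X ω, Z ω, Y ω))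
    (g := fun p => if B p.1 p.2.1 p.2.2 then 0 else ν p)
    (fun p => by
      split_ifs
      · exact le_rfl
      · exact hν0 p)
    (fun ω => by
      simp only [h ω, if_false]
      exact hνpos ω)
  have hsum : ∑ p, ν p = 1 := by
    simp only [hν, Fintype.sum_prod_type, ← mul_sum, ← sum_div, sum_law_pair_left]
    rw [← sum_law (fun ω => (X ω, Z ω)), Fintype.sum_prod_type]
    refine sum_congr rfl fun x _ => sum_congr rfl fun z _ => ?_
    rcases (law_nonneg Z z).eq_or_lt with h0 | h0
    · have : law (fun ω => (X ω, Z ω)) (x, z) ≤ law Z z :=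
        law_le_of_imp fun ω hω => (Prod.mk.inj hω).2
      rw [← h0] at this
      rw [le_antisymm this (law_nonneg _ _), zero_mul]
    · rw [div_self h0.ne', mul_one]
  have hB : ∑ p : α × γ × β, (if B p.1 p.2.1 p.2.2 then 0 else ν p) =
      1 - ∑ x, ∑ z, law (fun ω => (X ω, Z ω)) (x, z) *
      ∑ y, law (fun ω => (Y ω, Z ω)) (y, z) / law Z z * if B x z y then 1 else 0 := by
    refine eq_sub_of_add_eq (Eq.trans ?_ hsum)
    have : (∑ x, ∑ z, law (fun ω => (X ω, Z ω)) (x, z) *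
        ∑ y, law (fun ω => (Y ω, Z ω)) (y, z) / law Z z * if B x z y then 1 else 0) =
        ∑ p : α × γ × β, ν p * if B p.1 p.2.1 p.2.2 then 1 else 0 := by
      simp only [hν, Fintype.sum_prod_type, mul_sum, mul_assoc]
    rw [this, ← sum_add_distrib]
    refine sum_congr rfl fun p _ => ?_
    split_ifs <;> simp
  have hpos : 0 < ∑ p : α × γ × β, (if B p.1 p.2.1 p.2.2 then 0 else ν p) := by
    obtain ⟨ω₀⟩ := ‹Nonempty Ω›
    have : Nonempty Ω := ⟨ω₀⟩
    refine lt_of_lt_of_le ?_ (single_le_sum (fun p _ => ?_) (mem_univ (X ω₀, Z ω₀, Y ω₀)))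
    · simp only [h ω₀, if_false]
      exact hνpos ω₀
    · split_ifs
      · exact le_rfl
      · exact hν0 p
  have hlog := log_le_sub_one_of_pos hpos
  rw [hB] at hlog hG
  have h1 : avg (fun ω => log (if B (X ω) (Z ω) (Y ω) then 0 else ν (X ω, Z ω, Y ω))) =
      -entropy (fun ω => (X ω, Z ω)) - entropy (fun ω => (Y ω, Z ω)) + entropy Z := by
    have h3 : ∀ ω, log (if B (X ω) (Z ω) (Y ω) then 0 else ν (X ω, Z ω, Y ω)) =
        log (law (fun ω => (X ω, Z ω)) (X ω, Z ω)) +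
        (log (law (fun ω => (Y ω, Z ω)) (Y ω, Z ω)) - log (law Z (Z ω))) := fun ω => by
      have a1 := law_pos (fun ω => (X ω, Z ω)) ω
      have a2 := law_pos (fun ω => (Y ω, Z ω)) ω
      have a3 := law_pos Z ω
      simp only [h ω, if_false, hν]
      rw [log_mul a1.ne' (div_pos a2 a3).ne', log_div a2.ne' a3.ne']
    simp only [h3, avg_add, avg_sub, entropy]
    ring
  rw [h1] at hG
  have h4 : entropy (fun ω => (X ω, Z ω, Y ω)) = entropy (fun ω => (X ω, Y ω, Z ω)) :=
    entropy_congr fun ω ω' => by simp [and_comm]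
  rw [h4] at hG
  linarith

/-- Conditional mutual information is nonnegative: `sum_markov_le` for the empty event. -/
lemma entropy_submodular [Nonempty Ω] [Fintype α] [Fintype β] [Fintype γ] (X : Ω → α)
    (Y : Ω → β) (Z : Ω → γ) :
    entropy (fun ω => (X ω, Y ω, Z ω)) + entropy Z ≤
      entropy (fun ω => (X ω, Z ω)) + entropy (fun ω => (Y ω, Z ω)) := by
  have := sum_markov_le X Y Z (fun _ _ _ => False) (fun _ => not_false)
  simp at this
  linarith

end FiniteEntropy

-- The corruption bound for block disjointness.

namespace BlockDisjointness

open Finset Real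

variable {q : ℕ}

/-- Few functions `t` hit given small sets `V b` at three quarters of the arguments. -/
lemma card_hits_le (V : Fin q → Finset (Fin q)) (hV : ∀ b, 4 * #(V b) ≤ q) :
    (#{t : Fin q → Fin q | 3 * q ≤ 4 * #{b | t b ∈ V b}} : ℝ) ≤ (19 / 32 : ℝ) ^ q * (q : ℝ) ^ q := by
  -- Exponential Markov inequality with weight 16 per hit: `16 ^ (3/4) = 8`, and a block averages at
  -- most `1 + 15/4 = 19/4`, whence the rate `(19/4)/8 = 19/32`.
  have key : ∀ t : Fin q → Fin q,
      (if 3 * q ≤ 4 * #{b | t b ∈ V b} then (8 : ℝ) ^ q else 0) ≤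
        ∏ b, (if t b ∈ V b then (16 : ℝ) else 1) := fun t => by
    rw [prod_ite, prod_const, prod_const_one, mul_one]
    split_ifs with h
    · have h1 : (8 : ℝ) ^ (q * 4) ≤ (16 : ℝ) ^ (#{b | t b ∈ V b} * 4) := by
        have : (8 : ℝ) ^ (q * 4) = 16 ^ (3 * q) := by
          rw [mul_comm q 4, pow_mul, pow_mul]
          norm_num
        rw [this]
        exact pow_le_pow_right₀ (by norm_num) (by omega)
      rw [pow_mul, pow_mul] at h1
      exact le_of_pow_le_pow_left₀ (by norm_num) (by positivity) h1
    · positivity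
  have h1 := sum_le_sum fun t (_ : t ∈ univ) => key t
  rw [← Fintype.prod_sum (fun b a => if a ∈ V b then (16 : ℝ) else 1)] at h1
  have h2 : ∀ b, ∑ a, (if a ∈ V b then (16 : ℝ) else 1) ≤ 19 / 4 * q := fun b => by
    have : ∀ a, (if a ∈ V b then (16 : ℝ) else 1) = 1 + if a ∈ V b then (15 : ℝ) else 0 :=
      fun a => by split_ifs <;> norm_num
    simp only [this, sum_add_distrib, sum_ite_mem, univ_inter, sum_const, card_univ,
      Fintype.card_fin, nsmul_eq_mul, mul_one]
    have := hV b
    have : (4 : ℝ) * #(V b) ≤ q := by exact_mod_cast this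
    linarith
  have h3 : ∏ b, ∑ a, (if a ∈ V b then (16 : ℝ) else 1) ≤ (19 / 4 * q : ℝ) ^ q := by
    calc _ ≤ ∏ _b : Fin q, (19 / 4 * q : ℝ) := prod_le_prod (fun b _ => by positivity) fun b _ => h2 b
      _ = _ := by simp
  rw [← sum_filter, sum_const, nsmul_eq_mul] at h1
  have h4 : (19 / 4 * q : ℝ) ^ q = (19 / 32 : ℝ) ^ q * (q : ℝ) ^ q * 8 ^ q := by
    rw [← mul_pow, ← mul_pow]
    congr 1
    ring
  exact le_of_mul_le_mul_right ((h1.trans h3).trans_eq h4) (by positivity)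

lemma card_avoid_le (V : Fin q → Finset (Fin q)) :
    (#{s : Fin q → Fin q | ∀ b, s b ∉ V b} : ℝ) ≤
      (q : ℝ) ^ q * exp (-((∑ b, #(V b) : ℕ) : ℝ) / q) := by
  rcases Nat.eq_zero_or_pos q with rfl | hq
  · simp
  have h : ({s : Fin q → Fin q | ∀ b, s b ∉ V b} : Finset _) =
      Fintype.piFinset fun b => (V b)ᶜ := by
    ext s
    simp
  have hq' : (0 : ℝ) < q := by exact_mod_cast hq
  rw [h, Fintype.card_piFinset]
  push_cast
  have h1 : ∀ b, ((#(V b)ᶜ : ℕ) : ℝ) ≤ q * exp (-(#(V b) : ℝ) / q) := fun b => by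
    have := add_one_le_exp (-(#(V b) : ℝ) / q)
    rw [card_compl, Fintype.card_fin, Nat.cast_sub (by simpa using card_le_univ (V b))]
    calc (q : ℝ) - #(V b) = q * (-(#(V b) : ℝ) / q + 1) := by
          field_simp
          ring
      _ ≤ _ := by gcongr
  calc ∏ b, ((#(V b)ᶜ : ℕ) : ℝ) ≤ ∏ b, (q * exp (-(#(V b) : ℝ) / q)) :=
        prod_le_prod (fun _ _ => by positivity) fun b _ => h1 b
    _ = _ := by
        rw [prod_mul_distrib, prod_const, card_univ, Fintype.card_fin, ← exp_sum, ← sum_div,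
          sum_neg_distrib]

/-- Greedy choice of functions `t` which are all disjoint from many elements of `C`. -/
lemma exists_avoided_sets (hq : 10 ≤ q) (h : (Fin q → Fin q) → ℝ) (h0 : ∀ t, 0 ≤ h t)
    (h1 : ∀ t, h t ≤ 1 / (q : ℝ) ^ q) (hg : (3 / 4 : ℝ) ^ q ≤ ∑ t, h t)
    (C : Finset (Fin q → Fin q))
    (hC : ∀ s ∈ C, 9 / 10 * ∑ t, h t ≤ ∑ t with ∀ b, s b ≠ t b, h t) (j : ℕ)
    (hj : 4 * j ≤ q) :
    ∃ V : Fin q → Finset (Fin q), (∀ b, #(V b) ≤ j) ∧ j * q ≤ 4 * ∑ b, #(V b) ∧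
      (4 / 5 : ℝ) ^ j * #C ≤ #{s ∈ C | ∀ b, s b ∉ V b} := by
  induction j with
  | zero => exact ⟨fun _ => ∅, by simp, by simp, by simp⟩
  | succ j ih =>
    obtain ⟨V, hV, hVsum, hVC⟩ := ih (by omega)
    set C' := {s ∈ C | ∀ b, s b ∉ V b} with hC'
    set g := ∑ t, h t with hgdef
    have hgpos : 0 < g := lt_of_lt_of_le (by positivity) hg
    -- A `t` that mostly revisits `V` would not enlarge it enough. Smoothness of `h` bounds the
    -- weight of all such `t` by `(19/32)^q = (19/24)^q * (3/4)^q`, at most a tenth of the total.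
    set bad : Finset (Fin q → Fin q) := {t | 3 * q ≤ 4 * #{b | t b ∈ V b}} with hbad
    have hbadsum : ∑ t ∈ bad, h t ≤ 1 / 10 * g := by
      have hqpos : (0 : ℝ) < (q : ℝ) ^ q := by positivity
      calc ∑ t ∈ bad, h t ≤ ∑ t ∈ bad, 1 / (q : ℝ) ^ q := sum_le_sum fun t _ => h1 t
        _ = #bad / (q : ℝ) ^ q := by rw [sum_const, nsmul_eq_mul]; ring
        _ ≤ (19 / 32 : ℝ) ^ q := by
            rw [div_le_iff₀ hqpos]
            exact card_hits_le V fun b => by have := hV b; omega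
        _ = (19 / 24 : ℝ) ^ q * (3 / 4 : ℝ) ^ q := by rw [← mul_pow]; norm_num
        _ ≤ (19 / 24 : ℝ) ^ 10 * (3 / 4 : ℝ) ^ q := by
            gcongr ?_ * _
            exact pow_le_pow_of_le_one (by norm_num) (by norm_num) hq
        _ ≤ 1 / 10 * g := by
            gcongr
            norm_num
    -- Double counting of disjoint pairs: otherwise `9/10 ≤ 4/5 + 1/5 * 1/10`.
    have hex : ∃ t, t ∉ bad ∧ 4 / 5 * (#C' : ℝ) ≤ #{s ∈ C' | ∀ b, s b ≠ t b} := by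
      by_contra! hcon
      rcases Nat.eq_zero_or_pos #C' with hc0 | hcpos
      · have hb : ∃ t, t ∉ bad := by
          by_contra! hall
          have : bad = univ := by ext t; simp [hall t]
          rw [this, ← hgdef] at hbadsum
          linarith
        obtain ⟨t, ht⟩ := hb
        have := hcon t ht
        rw [hc0] at this
        norm_num at this
        linarith [(Nat.cast_nonneg _ : (0 : ℝ) ≤ (#{s ∈ C' | ∀ b, s b ≠ t b} : ℝ))]
      have hcpos' : (0 : ℝ) < #C' := by exact_mod_cast hcpos
      have e1 : 9 / 10 * g * #C' ≤ ∑ t, h t * #{s ∈ C' | ∀ b, s b ≠ t b} := by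
        have : ∑ s ∈ C', ∑ t with ∀ b, s b ≠ t b, h t =
            ∑ t, h t * #{s ∈ C' | ∀ b, s b ≠ t b} := by
          simp only [sum_filter]
          rw [sum_comm]
          refine sum_congr rfl fun t _ => ?_
          rw [← sum_filter, sum_const, nsmul_eq_mul, mul_comm]
        rw [← this]
        have := sum_le_sum fun s (hs : s ∈ C') => hC s (mem_filter.1 hs).1
        rw [sum_const, nsmul_eq_mul] at this
        linarith
      have e2 : ∑ t, h t * (#{s ∈ C' | ∀ b, s b ≠ t b} : ℝ) ≤
          (∑ t ∈ bad, h t) * #C' + (∑ t ∈ badᶜ, h t) * (4 / 5 * #C') := by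
        rw [← sum_add_sum_compl bad, sum_mul, sum_mul]
        refine add_le_add (sum_le_sum fun t _ => ?_) (sum_le_sum fun t ht => ?_)
        · exact mul_le_mul_of_nonneg_left (by exact_mod_cast card_filter_le _ _) (h0 t)
        · exact mul_le_mul_of_nonneg_left (hcon t (by simpa using ht)).le (h0 t)
      have e3 : ∑ t ∈ badᶜ, h t = g - ∑ t ∈ bad, h t := by
        rw [hgdef, ← sum_add_sum_compl bad h]
        ring
      rw [e3] at e2
      have e4 : 9 / 10 * g * #C' ≤ (4 / 5 * g + 1 / 5 * ∑ t ∈ bad, h t) * #C' := by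
        linarith
      have e5 := le_of_mul_le_mul_right e4 hcpos'
      linarith
    obtain ⟨t, ht, htC⟩ := hex
    refine ⟨fun b => insert (t b) (V b), fun b => ?_, ?_, ?_⟩
    · exact (card_insert_le _ _).trans (by have := hV b; omega)
    -- Every block is either hit or gains an element, so a `t` outside `bad` adds more than `q / 4`
    -- elements.
    · have hcount : #{b | t b ∈ V b} + ∑ b, #(insert (t b) (V b)) = q + ∑ b, #(V b) := by
        rw [card_filter, ← sum_add_distrib]
        have : ∀ b, (if t b ∈ V b then 1 else 0) + #(insert (t b) (V b)) = 1 + #(V b) :=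
          fun b => by
            split_ifs with hb
            · rw [insert_eq_of_mem hb]
            · rw [card_insert_of_notMem hb]; omega
        simp only [this, sum_add_distrib, sum_const, card_univ, Fintype.card_fin, smul_eq_mul,
          mul_one]
      have hnb : ¬ 3 * q ≤ 4 * #{b | t b ∈ V b} := by
        simpa [hbad] using ht
      change _ ≤ 4 * ∑ b, #(insert (t b) (V b))
      rw [Nat.succ_mul]
      omega
    · have : ({s ∈ C | ∀ b, s b ∉ insert (t b) (V b)} : Finset _) =
          {s ∈ C' | ∀ b, s b ≠ t b} := by
        ext s
        simp only [hC', mem_filter, mem_insert, not_or, forall_and]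
        tauto
      rw [this]
      calc (4 / 5 : ℝ) ^ (j + 1) * #C = 4 / 5 * ((4 / 5 : ℝ) ^ j * #C) := by ring
        _ ≤ 4 / 5 * #C' := by gcongr
        _ ≤ _ := htC

/-- Corruption bound: a smooth weight `h` on functions `t` is mostly supported on the functions
disjoint from `s` for very few `s` only. -/
lemma card_mostly_disjoint_le (hq : 10 ≤ q) (h : (Fin q → Fin q) → ℝ) (h0 : ∀ t, 0 ≤ h t)
    (h1 : ∀ t, h t ≤ 1 / (q : ℝ) ^ q) (hg : (3 / 4 : ℝ) ^ q ≤ ∑ t, h t) :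
    (#{s : Fin q → Fin q | 9 / 10 * ∑ t, h t ≤ ∑ t with ∀ b, s b ≠ t b, h t} : ℝ) ≤
      (q : ℝ) ^ q * exp (-(q : ℝ) / 400) := by
  set C : Finset (Fin q → Fin q) :=
    {s : Fin q → Fin q | 9 / 10 * ∑ t, h t ≤ ∑ t with ∀ b, s b ≠ t b, h t} with hC
  obtain ⟨V, -, hVsum, hVC⟩ := exists_avoided_sets hq h h0 h1 hg C
    (fun s hs => (mem_filter.1 hs).2) (q / 4) (by omega)
  set r := q / 4 with hr
  have hqpos : (0 : ℝ) < q := by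
    have : 0 < q := by omega
    exact_mod_cast this
  have hav := card_avoid_le V
  have hsub : (#{s ∈ C | ∀ b, s b ∉ V b} : ℝ) ≤ #{s : Fin q → Fin q | ∀ b, s b ∉ V b} := by
    exact_mod_cast card_le_card (filter_subset_filter _ (subset_univ _))
  have hsum : (r : ℝ) / 4 ≤ ((∑ b, #(V b) : ℕ) : ℝ) / q := by
    rw [div_le_div_iff₀ (by norm_num) hqpos]
    exact_mod_cast (by linarith : r * q ≤ (∑ b, #(V b)) * 4)
  have hexp : exp (-((∑ b, #(V b) : ℕ) : ℝ) / q) ≤ exp (-1 / 4) ^ r := by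
    rw [← exp_nat_mul]
    apply exp_le_exp.2
    rw [neg_div]
    linarith
  -- Each round keeps a fraction `4/5` of `C` but shrinks the bound on all avoiding functions by
  -- `exp (-1/4)`. The net gain `exp (-1/40)` over `r ≥ q / 10` rounds gives the exponent `q / 400`.
  have he : exp (-1 / 4) ≤ 4 / 5 * exp (-1 / 40) := by
    have h2 : exp (-1 / 4) = exp (-1/40) * exp (-9 / 40) := by
      rw [← exp_add]; norm_num
    have h3 : exp (-9 / 40) ≤ 4 / 5 := by
      rw [show (-9 / 40 : ℝ) = -(9/40) by ring, exp_neg, inv_le_comm₀ (exp_pos _) (by norm_num)]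
      have h6 := quadratic_le_exp_of_nonneg (x := (9 / 40 : ℝ)) (by norm_num)
      norm_num at h6 ⊢
      linarith
    rw [h2, mul_comm]
    gcongr
  have hfin : (4 / 5 : ℝ) ^ r * #C ≤ (4 / 5 : ℝ) ^ r * ((q : ℝ) ^ q * exp (-(q : ℝ) / 400)) := by
    calc (4 / 5 : ℝ) ^ r * #C ≤ (q : ℝ) ^ q * exp (-1 / 4) ^ r := by
          refine hVC.trans (hsub.trans (hav.trans ?_))
          gcongr
      _ ≤ (q : ℝ) ^ q * (4 / 5 * exp (-1 / 40)) ^ r := by gcongr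
      _ = (4 / 5 : ℝ) ^ r * ((q : ℝ) ^ q * exp (-1 / 40) ^ r) := by rw [mul_pow]; ring
      _ ≤ _ := by
          gcongr
          rw [← exp_nat_mul]
          apply exp_le_exp.2
          have : q ≤ 10 * r := by omega
          have : (q : ℝ) ≤ 10 * r := by exact_mod_cast this
          linarith
  exact le_of_mul_le_mul_left hfin (by positivity)

/-- The fraction is `(1 - 1/q)^q ≥ exp (-2) ≥ 1/8`. -/
lemma one_eighth_mul_le_card_disjoint (hq : 2 ≤ q) (s : Fin q → Fin q) :
    1 / 8 * (q : ℝ) ^ q ≤ #{t : Fin q → Fin q | ∀ b, s b ≠ t b} := by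
  have hset : ({t : Fin q → Fin q | ∀ b, s b ≠ t b} : Finset _) =
      Fintype.piFinset fun b => ({s b} : Finset (Fin q))ᶜ := by
    ext t
    simp [eq_comm]
  have hq' : (2 : ℝ) ≤ q := by exact_mod_cast hq
  rw [hset, Fintype.card_piFinset]
  simp only [card_compl, Fintype.card_fin, card_singleton, prod_const, card_univ]
  rw [Nat.cast_pow, Nat.cast_sub (by omega), Nat.cast_one]
  have h1 : exp (-2 / q) ≤ 1 - 1 / (q : ℝ) := by
    have hpos : (0 : ℝ) < 1 - 1 / q := by
      rw [sub_pos, div_lt_one (by linarith)]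
      linarith
    rw [← le_log_iff_exp_le hpos]
    refine le_trans ?_ (one_sub_inv_le_log_of_pos hpos)
    have hq1 : (0 : ℝ) < q - 1 := by linarith
    have : 1 - (1 - 1 / (q : ℝ))⁻¹ = -1 / (q - 1) := by
      field_simp
      ring
    rw [this, div_le_div_iff₀ (by linarith) hq1]
    linarith
  have h2 : (1 / 8 : ℝ) ≤ exp (-2) := by
    rw [exp_neg, one_div]
    apply inv_anti₀ (exp_pos _)
    have : exp 2 = exp 1 ^ 2 := by rw [← exp_nat_mul]; norm_num
    rw [this]
    have := exp_one_lt_d9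
    have h0 := exp_pos 1
    nlinarith
  have hq0 : (q : ℝ) ≠ 0 := by linarith
  calc 1 / 8 * (q : ℝ) ^ q ≤ exp (-2) * (q : ℝ) ^ q := by gcongr
    _ = (exp (-2 / q) * q) ^ q := by
        rw [mul_pow, ← exp_nat_mul]
        congr 2
        field_simp
    _ ≤ ((1 - 1 / (q : ℝ)) * q) ^ q := by gcongr
    _ = _ := by
        congr 1
        field_simp

end BlockDisjointness

-- Information carried by the messages, and the chain rule over the updates.

namespace FiniteEntropy

open Finset Real

lemma law_eq_of_equiv {Ω α : Type*} [Fintype Ω] {X : Ω → α} {a a' : α} (e : Ω ≃ Ω)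
    (h : ∀ ω, X (e ω) = a' ↔ X ω = a) : law X a = law X a' := by
  classical
  unfold law avg
  congr 1
  exact Fintype.sum_equiv e _ _ fun ω => by simp [h ω]

section UniformInputs

variable {F P N : Type*} [Fintype F] [Nonempty F] {k m : ℕ}

/-- The information about the independent uniform `S i` in short messages about all of `S`, on top
of the independent `T j`, is at most the length of the messages. -/
lemma sum_information_le [Fintype P] [Fintype N] (ρ : (Fin k → F) → F → P)
    (code : (Fin k → F) → F → N) (dec : N → P) (hcode : ∀ S T, dec (code S T) = ρ S T) :
    ∑ i, (log (Fintype.card F) +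
        entropy (fun (ω : (Fin k → F) × (Fin m → F)) j => (ω.2 j, ρ ω.1 (ω.2 j))) -
        entropy (fun ω : (Fin k → F) × (Fin m → F) =>
          (ω.1 i, fun j => (ω.2 j, ρ ω.1 (ω.2 j))))) ≤ m * log (Fintype.card N) := by
  classical
  set Y : (Fin k → F) × (Fin m → F) → Fin m → F × P := fun ω j => (ω.2 j, ρ ω.1 (ω.2 j)) with hY
  have h1 := entropy_pi_pair_le (fun ω : (Fin k → F) × (Fin m → F) => ω.1) Y
  -- The updates are part of `Y`, so `S` and `Y` together determine the whole input.
  have h2 : log (Fintype.card ((Fin k → F) × (Fin m → F))) ≤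
      entropy (fun ω : (Fin k → F) × (Fin m → F) => (ω.1, Y ω)) := by
    rw [← entropy_eq_log_card (fun ω : (Fin k → F) × (Fin m → F) => ω) Function.injective_id]
    refine entropy_mono fun ω ω' h => ?_
    simp only [hY, Prod.mk.injEq, funext_iff] at h
    exact Prod.ext (funext h.1) (funext fun j => (h.2 j).1)
  -- `T j` and the code determine `Y j`; thus the number of codes counts, not the size of `P`.
  have h3 : entropy Y ≤ log (Fintype.card (Fin m → F × N)) := by
    refine le_trans (entropy_mono (Y := fun (ω : (Fin k → F) × (Fin m → F)) (j : Fin m) =>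
      (ω.2 j, code ω.1 (ω.2 j))) fun ω ω' h => ?_) (entropy_le_log_card _)
    simp only [Prod.mk.injEq, funext_iff] at h
    funext j
    have h4 := (h j).2
    rw [(h j).1] at h4
    simp only [hY, ← hcode, (h j).1, h4]
  have hN : Nonempty N := ⟨code (fun _ => Classical.arbitrary F) (Classical.arbitrary F)⟩
  have hF0 : (Fintype.card F : ℝ) ≠ 0 := by exact_mod_cast Fintype.card_ne_zero
  have hN0 : (Fintype.card N : ℝ) ≠ 0 := by exact_mod_cast Fintype.card_ne_zero
  simp only [Fintype.card_prod, Fintype.card_fun, Fintype.card_fin, Nat.cast_mul,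
    Nat.cast_pow] at h2 h3
  rw [log_mul (pow_ne_zero _ hF0) (pow_ne_zero _ hF0), log_pow, log_pow] at h2
  rw [log_pow, log_mul hF0 hN0] at h3
  have h4 : ∑ i, (log (Fintype.card F) + entropy Y - entropy (fun ω => (ω.1 i, Y ω))) =
      k * log (Fintype.card F) -
        ∑ i, (entropy (fun ω : (Fin k → F) × (Fin m → F) => (ω.1 i, Y ω)) - entropy Y) := by
    simp only [sum_sub_distrib, sum_add_distrib, sum_const, card_univ, Fintype.card_fin,
      nsmul_eq_mul]
    ring
  rw [h4]
  linarith

end UniformInputs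

section PrefixConditioning

variable {Ω α β A : Type*} {m : ℕ}

/-- The variable `a` together with the first `j` entries of `Y`. -/
def withPrefix (a : Ω → A) (Y : Ω → Fin m → β) (j : ℕ) (ω : Ω) : A × (Fin m → Option β) :=
  (a ω, fun l => if (l : ℕ) < j then some (Y ω l) else none)

lemma withPrefix_eq_iff (a : Ω → A) (Y : Ω → Fin m → β) (j : ℕ) (ω ω' : Ω) :
    withPrefix a Y j ω = withPrefix a Y j ω' ↔
      a ω = a ω' ∧ ∀ l : Fin m, (l : ℕ) < j → Y ω l = Y ω' l := by
  simp only [withPrefix, Prod.mk.injEq, funext_iff]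
  refine and_congr_right fun _ => forall_congr' fun l => ?_
  by_cases h : (l : ℕ) < j <;> simp [h]

/-- For some `j`, conditioning on `a` and the first `j` entries of `Y` makes the next entry almost
independent of `X`, while it reveals little about `X`. -/
lemma exists_prefix [Fintype Ω] [Nonempty Ω] [Fintype α] [Fintype β] [Fintype A] (hm : 0 < m) (X : Ω → α)
    (a : Ω → A) (Y : Ω → Fin m → β) {d : ℝ}
    (hd : entropy X + entropy Y - entropy (fun ω => (X ω, Y ω)) + log (Fintype.card A) ≤ d) :
    ∃ j : Fin m,
      entropy X + entropy (withPrefix a Y j) - entropy (fun ω => (X ω, withPrefix a Y j ω)) ≤ d ∧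
      entropy (fun ω => (X ω, withPrefix a Y j ω)) +
        entropy (fun ω => (Y ω j, withPrefix a Y j ω)) -
        entropy (fun ω => (X ω, Y ω j, withPrefix a Y j ω)) - entropy (withPrefix a Y j) ≤
          d / m := by
  classical
  -- The mutual information of `X` with `a` and the first `j` entries. Its increments are
  -- conditional mutual informations, so it increases from `f 0 ≥ 0` to `f m ≤ d` and some increment
  -- is at most the average `d / m`.
  set f : ℕ → ℝ := fun j => entropy X + entropy (withPrefix a Y j) -
    entropy (fun ω => (X ω, withPrefix a Y j ω)) with hf
  have hstep : ∀ j : Fin m, f (j + 1) - f j = entropy (fun ω => (X ω, withPrefix a Y j ω)) +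
        entropy (fun ω => (Y ω j, withPrefix a Y j ω)) -
        entropy (fun ω => (X ω, Y ω j, withPrefix a Y j ω)) - entropy (withPrefix a Y j) := by
    intro j
    have hZ : ∀ ω ω', withPrefix a Y (j + 1) ω = withPrefix a Y (j + 1) ω' ↔
        Y ω j = Y ω' j ∧ withPrefix a Y j ω = withPrefix a Y j ω' := fun ω ω' => by
      simp only [withPrefix_eq_iff]
      constructor
      · rintro ⟨h1, h2⟩
        exact ⟨h2 j (by omega), h1, fun l hl => h2 l (by omega)⟩
      · rintro ⟨h1, h2, h3⟩
        refine ⟨h2, fun l hl => ?_⟩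
        rcases Nat.lt_succ_iff_lt_or_eq.1 hl with h | h
        · exact h3 l h
        · rw [Fin.ext h, h1]
    have e1 : entropy (withPrefix a Y (j + 1)) = entropy (fun ω => (Y ω j, withPrefix a Y j ω)) :=
      entropy_congr fun ω ω' => by rw [hZ]; simp only [Prod.mk.injEq]
    have e2 : entropy (fun ω => (X ω, withPrefix a Y (j + 1) ω)) =
        entropy (fun ω => (X ω, Y ω j, withPrefix a Y j ω)) :=
      entropy_congr fun ω ω' => by simp only [Prod.mk.injEq, hZ]
    simp only [hf, e1, e2]
    ring
  have hmono : ∀ j : Fin m, f j ≤ f (j + 1) := fun j => by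
    have := entropy_submodular X (fun ω => Y ω j) (withPrefix a Y j)
    linarith [hstep j]
  have h0 : 0 ≤ f 0 := by
    have := entropy_pair_le X (withPrefix a Y 0)
    simp only [hf]
    linarith
  have hend : f m ≤ d := by
    have e1 : entropy (withPrefix a Y m) ≤ log (Fintype.card A) + entropy Y := by
      refine le_trans (le_trans ?_ (entropy_pair_le a Y)) (by linarith [entropy_le_log_card a])
      refine entropy_mono fun ω ω' h => ?_
      rw [Prod.mk.injEq] at h
      rw [withPrefix_eq_iff]
      exact ⟨h.1, fun l _ => by rw [h.2]⟩
    have e2 : entropy (fun ω => (X ω, Y ω)) ≤ entropy (fun ω => (X ω, withPrefix a Y m ω)) := by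
      refine entropy_mono fun ω ω' h => ?_
      rw [Prod.mk.injEq, withPrefix_eq_iff] at h
      rw [Prod.mk.injEq]
      exact ⟨h.1, funext fun l => h.2.2 l l.2⟩
    simp only [hf]
    linarith
  have hle : ∀ j ≤ m, f j ≤ f m := fun j hj => by
    induction hj using Nat.decreasingInduction with
    | self => exact le_rfl
    | of_succ i hi ih => exact (hmono ⟨i, hi⟩).trans ih
  have hm' : (0 : ℝ) < m := by exact_mod_cast hm
  have hex : ∃ j : Fin m, f (j + 1) - f j ≤ d / m := by
    by_contra! hcon
    have : Nonempty (Fin m) := ⟨⟨0, hm⟩⟩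
    have h1 : ∑ _j : Fin m, d / m < ∑ j : Fin m, (f (j + 1) - f j) :=
      sum_lt_sum_of_nonempty univ_nonempty fun j _ => hcon j
    rw [Fin.sum_univ_eq_sum_range (fun j => f (j + 1) - f j), sum_range_sub, sum_const, card_univ,
      Fintype.card_fin, nsmul_eq_mul, mul_div_cancel₀ _ hm'.ne'] at h1
    linarith
  obtain ⟨j, hj⟩ := hex
  exact ⟨j, (hle j j.2.le).trans hend, (hstep j).symm.trans_le hj⟩

end PrefixConditioning

end FiniteEntropy

-- Error of a short protocol on a typical input.

namespace BlockDisjointness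

open Finset Real FiniteEntropy

variable {q : ℕ} {P Q : Type*} [Fintype P]

open Classical in
/-- The weight of the inputs `(t, p)` with `p ∈ G`. -/
noncomputable def rectWeight (κ : (Fin q → Fin q) × P → ℝ) (G : P → Prop) : ℝ :=
  ∑ t, ∑ p, if G p then κ (t, p) else 0

open Classical in
/-- The weight of the inputs `(t, p)` with `p ∈ G` and `t` disjoint from `x`. -/
noncomputable def disjointWeight (κ : (Fin q → Fin q) × P → ℝ) (G : P → Prop)
    (x : Fin q → Fin q) : ℝ :=
  ∑ t with ∀ b, x b ≠ t b, ∑ p, if G p then κ (t, p) else 0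

/-- The input `x` makes some heavy rectangle almost free of intersecting pairs. -/
def AtypicalInput (κ : (Fin q → Fin q) × P → ℝ) (G : Q → P → Prop) (x : Fin q → Fin q) : Prop :=
  ∃ σ, (3 / 4 : ℝ) ^ q ≤ rectWeight κ (G σ) ∧
    9 / 10 * rectWeight κ (G σ) ≤ disjointWeight κ (G σ) x

-- A union bound over transcripts, possible because `G σ` does not depend on `x`. The uniform
-- marginal of `t` under `κ` makes each rectangle's weight smooth enough for corruption.
open Classical in
lemma card_atypicalInput_le [Fintype Q] (hq : 10 ≤ q) {κ : (Fin q → Fin q) × P → ℝ}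
    (hκ0 : ∀ y, 0 ≤ κ y) (hκ : ∀ t, ∑ p, κ (t, p) = 1 / (q : ℝ) ^ q) (G : Q → P → Prop) :
    (#{x | AtypicalInput κ G x} : ℝ) ≤
      Fintype.card Q * ((q : ℝ) ^ q * exp (-(q : ℝ) / 400)) := by
  have hsub : ({x | AtypicalInput κ G x} : Finset _) ⊆ univ.biUnion fun σ =>
      {x | (3 / 4 : ℝ) ^ q ≤ rectWeight κ (G σ) ∧
        9 / 10 * rectWeight κ (G σ) ≤ disjointWeight κ (G σ) x} := by
    intro x hx
    obtain ⟨σ, hσ⟩ := (mem_filter.1 hx).2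
    simp only [mem_biUnion, mem_univ, true_and, mem_filter]
    exact ⟨σ, hσ⟩
  have h1 : ∀ σ, (#{x | (3 / 4 : ℝ) ^ q ≤ rectWeight κ (G σ) ∧
        9 / 10 * rectWeight κ (G σ) ≤ disjointWeight κ (G σ) x} : ℝ) ≤
      (q : ℝ) ^ q * exp (-(q : ℝ) / 400) := fun σ => by
    by_cases hσ : (3 / 4 : ℝ) ^ q ≤ rectWeight κ (G σ)
    · simp only [hσ, true_and]
      refine card_mostly_disjoint_le hq (fun t => ∑ p, if G σ p then κ (t, p) else 0)
        (fun t => sum_nonneg fun p _ => ?_) (fun t => ?_) hσ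
      · split_ifs
        · exact hκ0 _
        · exact le_rfl
      · rw [← hκ t]
        refine sum_le_sum fun p _ => ?_
        split_ifs
        · exact le_rfl
        · exact hκ0 _
    · simp only [hσ, false_and, filter_false, card_empty, Nat.cast_zero]
      positivity
  calc (#{x | AtypicalInput κ G x} : ℝ) ≤ ∑ σ, (#{x | (3 / 4 : ℝ) ^ q ≤ rectWeight κ (G σ) ∧
        9 / 10 * rectWeight κ (G σ) ≤ disjointWeight κ (G σ) x} : ℝ) := by
        exact_mod_cast (card_le_card hsub).trans card_biUnion_le
    _ ≤ ∑ _σ : Q, (q : ℝ) ^ q * exp (-(q : ℝ) / 400) := sum_le_sum fun σ _ => h1 σ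
    _ = _ := by rw [sum_const, card_univ, nsmul_eq_mul]

open Classical in
/-- The error of a protocol with rectangles `G` on a typical input. -/
lemma one_eighth_le_of_not_atypicalInput [Fintype Q] (hq : 2 ≤ q)
    {κ : (Fin q → Fin q) × P → ℝ} (hκ0 : ∀ y, 0 ≤ κ y)
    (hκ : ∀ t, ∑ p, κ (t, p) = 1 / (q : ℝ) ^ q) (G : Q → P → Prop) {x : Fin q → Fin q}
    (hx : ¬ AtypicalInput κ G x) (tr : P → Q) (out : P → Bool)
    (htr : ∀ p p', tr p' = tr p ↔ G (tr p) p') (hout : ∀ p p', tr p' = tr p → out p' = out p) :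
    1 / 8 ≤ Fintype.card Q * (3 / 4 : ℝ) ^ q +
      11 * ∑ y, κ y * if (out y.2 = true ↔ ¬ ∀ b, x b ≠ y.1 b) then 1 else 0 := by
  set dis : (Fin q → Fin q) → Prop := fun t => ∀ b, x b ≠ t b with hdis
  set E := ∑ y, κ y * if (out y.2 = true ↔ ¬ dis y.1) then (1 : ℝ) else 0 with hE
  set R := ∑ y, κ y * if out y.2 = true then (1 : ℝ) else 0 with hR
  have hqpos : (0 : ℝ) < (q : ℝ) ^ q := by
    have : (0 : ℝ) < q := by exact_mod_cast (by omega : 0 < q)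
    positivity
  -- Each disjoint pair is either accepted (`R`) or an error (`E`).
  have h1 : 1 / 8 ≤ R + E := by
    calc (1 / 8 : ℝ) ≤ #{t : Fin q → Fin q | dis t} / (q : ℝ) ^ q := by
          rw [le_div_iff₀ hqpos]
          exact one_eighth_mul_le_card_disjoint hq x
      _ = ∑ y, κ y * if dis y.1 then (1 : ℝ) else 0 := by
          rw [Fintype.sum_prod_type]
          have (t : Fin q → Fin q) : ∑ p, κ (t, p) * (if dis t then (1 : ℝ) else 0) =
              if dis t then 1 / (q : ℝ) ^ q else 0 := by
            rw [← sum_mul, hκ, mul_ite, mul_one, mul_zero]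
          simp only [this]
          rw [← sum_filter, sum_const, nsmul_eq_mul, mul_one_div]
      _ ≤ R + E := by
          rw [hR, hE, ← sum_add_distrib]
          refine sum_le_sum fun y _ => ?_
          rw [← mul_add]
          refine mul_le_mul_of_nonneg_left ?_ (hκ0 y)
          by_cases h1 : dis y.1 <;> by_cases h2 : out y.2 = true <;> simp [h1, h2]
  -- Split by transcript, on which the output is constant. A light accepting rectangle costs at most
  -- `(3/4)^q`; in a heavy one more than a tenth of the weight intersects `x` and is error.
  have h2 : R ≤ Fintype.card Q * (3 / 4 : ℝ) ^ q + 10 * E := by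
    have hRsum : R = ∑ σ, ∑ y, κ y * if out y.2 = true ∧ tr y.2 = σ then (1 : ℝ) else 0 := by
      rw [sum_comm, hR]
      refine sum_congr rfl fun y _ => ?_
      rw [← mul_sum]
      by_cases h : out y.2 = true <;> simp [h]
    have hEsum : E = ∑ σ, ∑ y, κ y *
        if (out y.2 = true ↔ ¬ dis y.1) ∧ tr y.2 = σ then (1 : ℝ) else 0 := by
      rw [sum_comm, hE]
      refine sum_congr rfl fun y _ => ?_
      rw [← mul_sum]
      by_cases h : (out y.2 = true ↔ ¬ dis y.1) <;> simp [h]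
    rw [hRsum, hEsum, mul_sum, ← nsmul_eq_mul, ← card_univ, ← sum_const, ← sum_add_distrib]
    refine sum_le_sum fun σ _ => ?_
    have hE0 : 0 ≤ ∑ y, κ y *
        if (out y.2 = true ↔ ¬ dis y.1) ∧ tr y.2 = σ then (1 : ℝ) else 0 :=
      sum_nonneg fun y _ => mul_nonneg (hκ0 y) (by positivity)
    by_cases hp : ∃ p, tr p = σ ∧ out p = true
    · obtain ⟨p, rfl, hpo⟩ := hp
      have e1 : ∑ y, κ y * (if out y.2 = true ∧ tr y.2 = tr p then (1 : ℝ) else 0) =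
          rectWeight κ (G (tr p)) := by
        rw [rectWeight, Fintype.sum_prod_type]
        refine sum_congr rfl fun t _ => sum_congr rfl fun p' _ => ?_
        by_cases h : G (tr p) p'
        · simp [h, (htr p p').2 h, (hout p p' ((htr p p').2 h)).trans hpo]
        · simp [h, htr p p']
      have e2 : rectWeight κ (G (tr p)) = disjointWeight κ (G (tr p)) x +
          ∑ y, κ y * if (out y.2 = true ↔ ¬ dis y.1) ∧ tr y.2 = tr p then (1 : ℝ) else 0 := by
        rw [rectWeight, disjointWeight, Fintype.sum_prod_type, sum_filter, ← sum_add_distrib]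
        refine sum_congr rfl fun t _ => ?_
        by_cases hd : dis t
        · have hd' : ∀ b, x b ≠ t b := hd
          rw [if_pos hd', left_eq_add]
          refine sum_eq_zero fun p' _ => ?_
          have : ¬ ((out p' = true ↔ ¬ dis t) ∧ tr p' = tr p) := by
            rintro ⟨h, h'⟩
            exact h.1 ((hout p p' h').trans hpo) hd
          simp only [this, if_false, mul_zero]
        · have hd' : ¬ ∀ b, x b ≠ t b := hd
          rw [if_neg hd', zero_add]
          refine sum_congr rfl fun p' _ => ?_
          by_cases h : G (tr p) p'
          · have h3 := (htr p p').2 h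
            simp [h, h3, (hout p p' h3).trans hpo, hd]
          · simp [h, htr p p']
      rw [e1]
      by_cases hg : (3 / 4 : ℝ) ^ q ≤ rectWeight κ (G (tr p))
      · have h3 : ¬ 9 / 10 * rectWeight κ (G (tr p)) ≤ disjointWeight κ (G (tr p)) x :=
          fun h => hx ⟨tr p, hg, h⟩
        have : (0 : ℝ) ≤ (3 / 4) ^ q := by positivity
        linarith
      · linarith
    · have : ∑ y, κ y * (if out y.2 = true ∧ tr y.2 = σ then (1 : ℝ) else 0) = 0 := by
        refine sum_eq_zero fun y _ => ?_
        have : ¬ (out y.2 = true ∧ tr y.2 = σ) := fun h => hp ⟨y.2, h.2, h.1⟩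
        simp only [this, if_false, mul_zero]
      rw [this]
      positivity
  linarith

end BlockDisjointness

-- Decoupling: no efficient protocol with advice exists.

namespace BlockDisjointness

open Finset Real FiniteEntropy

variable {q k m : ℕ}

/-- An equivalence of input tuples which moves the inputs with `T j = t` to those with
`T j = t'`. -/
def swapUpdate {K F : Type*} [DecidableEq F] (j : Fin m) (t t' : F) :
    K × (Fin m → F) ≃ K × (Fin m → F) :=
  Equiv.prodCongr (Equiv.refl K)
    (Equiv.piCongrRight fun l => if l = j then Equiv.swap t t' else Equiv.refl F)

/-- The prefix involves only `S` and the updates before `j`, so permuting the values of `T j` fixes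
it: `T j` stays uniform given the prefix. -/
lemma law_update_prefix {F P A : Type*} [Fintype F] [Nonempty F] (ρ : (Fin k → F) → F → P)
    (a : (Fin k → F) → A) (j : Fin m) (t : F) (z : A × (Fin m → Option (F × P))) :
    law (fun ω : (Fin k → F) × (Fin m → F) =>
        (ω.2 j, withPrefix (fun ω => a ω.1) (fun ω l => (ω.2 l, ρ ω.1 (ω.2 l))) j ω)) (t, z) =
      law (withPrefix (fun ω : (Fin k → F) × (Fin m → F) => a ω.1)
        (fun ω l => (ω.2 l, ρ ω.1 (ω.2 l))) j) z / Fintype.card F := by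
  classical
  set Z := withPrefix (fun ω : (Fin k → F) × (Fin m → F) => a ω.1)
        (fun ω l => (ω.2 l, ρ ω.1 (ω.2 l))) j with hZ
  have h : ∀ t', law (fun ω : (Fin k → F) × (Fin m → F) => (ω.2 j, Z ω)) (t', z) =
      law (fun ω : (Fin k → F) × (Fin m → F) => (ω.2 j, Z ω)) (t, z) := fun t' => by
    refine law_eq_of_equiv (swapUpdate j t' t) fun ω => ?_
    have h1 : Z (swapUpdate j t' t ω) = Z ω := by
      rw [hZ, withPrefix_eq_iff]
      refine ⟨rfl, fun l hl => ?_⟩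
      have : l ≠ j := fun h => by simp [h] at hl
      simp [swapUpdate, this]
    have h2 : (swapUpdate j t' t ω).2 j = Equiv.swap t' t (ω.2 j) := by
      simp [swapUpdate]
    change ((swapUpdate j t' t ω).2 j, Z (swapUpdate j t' t ω)) = (t, z) ↔ _
    rw [h1, h2]
    simp only [Prod.mk.injEq, Equiv.swap_apply_eq_iff, Equiv.swap_apply_right]
  have h3 := sum_law_pair_left (fun ω : (Fin k → F) × (Fin m → F) => ω.2 j) Z z
  simp only [h, sum_const, card_univ, nsmul_eq_mul] at h3
  rw [← h3, mul_div_cancel_left₀]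
  exact_mod_cast Fintype.card_ne_zero

lemma law_set_eq {F : Type*} [Fintype F] [Nonempty F] (i : Fin k) (x : F) :
    law (fun ω : (Fin k → F) × (Fin m → F) => ω.1 i) x = 1 / Fintype.card F := by
  classical
  have h : ∀ x', law (fun ω : (Fin k → F) × (Fin m → F) => ω.1 i) x' =
      law (fun ω : (Fin k → F) × (Fin m → F) => ω.1 i) x := fun x' => by
    refine law_eq_of_equiv ((Equiv.prodComm _ _).trans
      ((swapUpdate i x' x).trans (Equiv.prodComm _ _))) fun ω => ?_
    simp [swapUpdate, Equiv.swap_apply_eq_iff]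
  have h3 := sum_law (fun ω : (Fin k → F) × (Fin m → F) => ω.1 i)
  simp only [h, sum_const, card_univ, nsmul_eq_mul] at h3
  rw [eq_div_iff (by exact_mod_cast Fintype.card_ne_zero), mul_comm]
  exact h3

/-- There is no efficient protocol in which Alice knows `S i` and short advice depending on `S`
only, Bob knows `T` and `ρ S T`, and the number of possible values of `ρ S T` is too small to
record the answers for all `i`. -/
theorem false_of_protocol {A P Q N : Type*} [Fintype A] [Fintype P] [Fintype Q] [Fintype N]
    (hq : 100000 ≤ q) (hk : 0 < k) (ρ : (Fin k → Fin q → Fin q) → (Fin q → Fin q) → P)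
    (code : (Fin k → Fin q → Fin q) → (Fin q → Fin q) → N) (dec : N → P)
    (hcode : ∀ S T, dec (code S T) = ρ S T) (adv : Fin k → (Fin k → Fin q → Fin q) → A)
    (tr : Fin k → (Fin q → Fin q) → A → P → Q) (out : Fin k → (Fin q → Fin q) → A → P → Bool)
    (G : Q → P → Prop)
    (htr : ∀ i x a p p', tr i x a p' = tr i x a p ↔ G (tr i x a p) p')
    (hout : ∀ i x a p p', tr i x a p' = tr i x a p → out i x a p' = out i x a p)
    (correct : ∀ S T i, out i (S i) (adv i S) (ρ S T) = true ↔ ∀ b, S i b ≠ T b)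
    (hN : log (Fintype.card N) ≤ k / 100000) (hA : log (Fintype.card A) ≤ q / 100000)
    (hQ : log (Fintype.card Q) ≤ q / 100000) : False := by
  classical
  have hF : Nonempty (Fin q → Fin q) := ⟨id⟩
  have hq' : (100000 : ℝ) ≤ q := by exact_mod_cast hq
  have hk' : (0 : ℝ) < k := by exact_mod_cast hk
  have hqq : (0 : ℝ) < (q : ℝ) ^ q := by positivity
  have hcardF : (Fintype.card (Fin q → Fin q) : ℝ) = (q : ℝ) ^ q := by simp
  set Y : (Fin k → Fin q → Fin q) × (Fin q → Fin q → Fin q) → Fin q → (Fin q → Fin q) × P :=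
    fun ω j => (ω.2 j, ρ ω.1 (ω.2 j)) with hY
  obtain ⟨i, hi⟩ : ∃ i : Fin k, log (Fintype.card (Fin q → Fin q)) + entropy Y -
      entropy (fun ω => (ω.1 i, Y ω)) ≤ q / 100000 := by
    by_contra! hcon
    have : Nonempty (Fin k) := ⟨⟨0, hk⟩⟩
    have h1 := sum_information_le (m := q) ρ code dec hcode
    have h2 := sum_lt_sum_of_nonempty (univ_nonempty (α := Fin k)) fun i _ => hcon i
    rw [sum_const, card_univ, Fintype.card_fin, nsmul_eq_mul] at h2
    have h3 : (q : ℝ) * log (Fintype.card N) ≤ q * (k / 100000) := by gcongr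
    have h4 : (k : ℝ) * (q / 100000) = q * (k / 100000) := by ring
    linarith
  have hX : entropy (fun ω : (Fin k → Fin q → Fin q) × (Fin q → Fin q → Fin q) => ω.1 i) =
      log (Fintype.card (Fin q → Fin q)) := by
    rw [entropy_of_law_eq _ _ (law_set_eq i), one_div, log_inv, neg_neg]
  -- Messages and advice contribute `q / 100000` each. Spread over `q` updates, this leaves the
  -- constant `2 / 100000` for the conditional information.
  obtain ⟨j, hj1, hj2⟩ := exists_prefix (d := 2 * q / 100000) (by omega : 0 < q)
    (fun ω : (Fin k → Fin q → Fin q) × (Fin q → Fin q → Fin q) => ω.1 i)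
    (fun ω => adv i ω.1) Y (by rw [hX]; linarith)
  set Z := withPrefix (fun ω : (Fin k → Fin q → Fin q) × (Fin q → Fin q → Fin q) => adv i ω.1)
    Y j with hZ
  set X := fun ω : (Fin k → Fin q → Fin q) × (Fin q → Fin q → Fin q) => ω.1 i with hXdef
  set κ : A × (Fin q → Option ((Fin q → Fin q) × P)) → (Fin q → Fin q) × P → ℝ :=
    fun z y => law (fun ω => (Y ω j, Z ω)) (y, z) / law Z z with hκdef
  have hκ0 : ∀ z y, 0 ≤ κ z y := fun z y => div_nonneg (law_nonneg _ _) (law_nonneg _ _)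
  have hκ : ∀ z, 0 < law Z z → ∀ t, ∑ p, κ z (t, p) = 1 / (q : ℝ) ^ q := fun z hz t => by
    have h1 : ∀ p, law (fun ω => (Y ω j, Z ω)) ((t, p), z) =
        law (fun ω => ((ω.2 j, Z ω), ρ ω.1 (ω.2 j))) ((t, z), p) := fun p => by
      apply le_antisymm <;> refine law_le_of_imp fun ω hω => ?_ <;>
        simp only [hY, Prod.mk.injEq] at hω ⊢ <;> tauto
    simp only [hκdef]
    rw [← sum_div]
    simp only [h1]
    rw [sum_law_pair_right, hZ, hY, law_update_prefix ρ (adv i) j t z, hcardF, div_right_comm,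
      div_self hz.ne']
  obtain ⟨B, hB⟩ : ∃ B : (Fin q → Fin q) → A × (Fin q → Option ((Fin q → Fin q) × P)) →
      (Fin q → Fin q) × P → Prop,
      ∀ x z y, B x z y ↔ (out i x z.1 y.2 = true ↔ ¬ ∀ b, x b ≠ y.1 b) :=
    ⟨_, fun _ _ _ => Iff.rfl⟩
  -- Under the true joint law the protocol never errs, so all error comes from the decoupling.
  have herr := sum_markov_le X (fun ω => Y ω j) Z B fun ω h => by
    have h1 := correct ω.1 (ω.2 j) i
    have h2 : out i (ω.1 i) (adv i ω.1) (ρ ω.1 (ω.2 j)) = true ↔ ¬ ∀ b, ω.1 i b ≠ ω.2 j b :=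
      (hB _ _ _).1 h
    tauto
  set ν := ∑ x, ∑ z, law (fun ω => (X ω, Z ω)) (x, z) *
      ∑ y, law (fun ω => (Y ω j, Z ω)) (y, z) / law Z z * if B x z y then (1 : ℝ) else 0 with hν
  have hν2 : ν ≤ 2 / 100000 := by
    refine (herr.trans hj2).trans_eq ?_
    field_simp
  obtain ⟨bad, hbad⟩ : ∃ bad : (Fin q → Fin q) → A × (Fin q → Option ((Fin q → Fin q) × P)) →
      Prop, ∀ x z, bad x z ↔ 0 < law Z z ∧ AtypicalInput (κ z) G x :=
    ⟨_, fun _ _ => Iff.rfl⟩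
  set δ : ℝ := Fintype.card Q * exp (-(q : ℝ) / 400) with hδ
  have hQ' : (Fintype.card Q : ℝ) ≤ exp (q / 100000) := by
    rcases (Nat.cast_nonneg (Fintype.card Q) : (0 : ℝ) ≤ Fintype.card Q).eq_or_lt with h | h
    · rw [← h]
      positivity
    · exact (log_le_iff_le_exp h).1 hQ
  -- Half the corruption exponent `q / 400`: this keeps `exp c * δ ≤ 1`, and division by `c` gives
  -- `β ≤ 800 * 2 / 100000 + 800 / q ≤ 1 / 40`.
  have hbadle := mul_sum_law_le X Z bad (c := q / 800) (δ := δ) fun z => by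
    by_cases hz : 0 < law Z z
    · have h1 := card_atypicalInput_le (by omega) (hκ0 z) (hκ z hz) G
      simp only [hbad, hz, true_and, hXdef, law_set_eq, hcardF]
      rw [← mul_sum, sum_boole, one_div, inv_mul_le_iff₀ hqq, hδ]
      linarith
    · simp only [hbad, hz, false_and, if_false, mul_zero, sum_const_zero]
      positivity
  set β := ∑ x, ∑ z, law (fun ω => (X ω, Z ω)) (x, z) * if bad x z then (1 : ℝ) else 0 with hβ
  have hδ1 : exp (q / 800) * δ ≤ 1 := by
    calc exp (q / 800) * δ ≤ exp (q / 800) * (exp (q / 100000) * exp (-(q : ℝ) / 400)) := by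
          rw [hδ]
          gcongr
      _ = exp (-(q * (1 / 800 - 1 / 100000))) := by
          rw [← exp_add, ← exp_add]
          congr 1
          ring
      _ ≤ 1 := by
          rw [exp_le_one_iff]
          nlinarith
  have hδ0 : 0 ≤ exp (q / 800) * δ := by positivity
  have hβ2 : β ≤ 1 / 40 := by
    have h1 : log (1 + exp (q / 800) * δ) ≤ 1 := by
      have := log_le_sub_one_of_pos (by linarith : 0 < 1 + exp (q / 800) * δ)
      linarith
    have h2 : (q : ℝ) / 800 * β ≤ 2 * q / 100000 + 1 := by linarith
    have h3 : (q : ℝ) / 800 * β ≤ q / 800 * (1 / 40) := by linarith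
    exact le_of_mul_le_mul_left h3 (by positivity)
  set τ : ℝ := Fintype.card Q * (3 / 4 : ℝ) ^ q with hτ
  have hτ0 : 0 ≤ τ := by positivity
  have hτ2 : τ ≤ 1 / 1000 := by
    have h1 : (3 / 4 : ℝ) ≤ exp (-1 / 4) := by
      have := add_one_le_exp (-1 / 4 : ℝ)
      linarith
    calc τ ≤ exp (q / 100000) * exp (-1 / 4) ^ q := by
          rw [hτ]
          gcongr
      _ = exp (-(q * (1 / 4 - 1 / 100000))) := by
          rw [← exp_nat_mul, ← exp_add]
          congr 1
          ring
      _ ≤ 1 / 1000 := by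
          rw [exp_neg, one_div (1000 : ℝ)]
          apply inv_anti₀ (by norm_num)
          have := add_one_le_exp (q * (1 / 4 - 1 / 100000) : ℝ)
          nlinarith
  -- Summed over `x` and `z`, this reads `1/8 ≤ β + τ + 11 * ν`, which the three bounds contradict.
  have hrow : ∀ x z, law (fun ω => (X ω, Z ω)) (x, z) * (1 / 8) ≤
      law (fun ω => (X ω, Z ω)) (x, z) * (if bad x z then 1 else 0) +
      law (fun ω => (X ω, Z ω)) (x, z) * τ +
      11 * (law (fun ω => (X ω, Z ω)) (x, z) *
        ∑ y, law (fun ω => (Y ω j, Z ω)) (y, z) / law Z z * if B x z y then (1 : ℝ) else 0) := by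
    intro x z
    have hle : law (fun ω => (X ω, Z ω)) (x, z) ≤ law Z z :=
      law_le_of_imp fun ω hω => (Prod.mk.inj hω).2
    rcases (law_nonneg (fun ω => (X ω, Z ω)) (x, z)).eq_or_lt with h0 | h0
    · rw [← h0]
      simp
    have hz := h0.trans_le hle
    have hE0 : 0 ≤ ∑ y, κ z y * if B x z y then (1 : ℝ) else 0 :=
      sum_nonneg fun y _ => mul_nonneg (hκ0 z y) (by positivity)
    have key : (1 : ℝ) / 8 ≤ (if bad x z then 1 else 0) + τ +
        11 * ∑ y, κ z y * if B x z y then (1 : ℝ) else 0 := by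
      by_cases hb : AtypicalInput (κ z) G x
      · have : bad x z := (hbad x z).2 ⟨hz, hb⟩
        rw [if_pos this]
        linarith
      · have : ¬ bad x z := fun h => hb ((hbad x z).1 h).2
        rw [if_neg this, zero_add]
        simp only [hB]
        exact one_eighth_le_of_not_atypicalInput (by omega) (hκ0 z) (hκ z hz) G hb
          (tr i x z.1) (out i x z.1) (fun p p' => htr i x z.1 p p')
          (fun p p' => hout i x z.1 p p')
    have := mul_le_mul_of_nonneg_left key h0.le
    simp only [hκdef] at this
    linarith
  have hsum := sum_le_sum fun x (_ : x ∈ univ) => sum_le_sum fun z (_ : z ∈ univ) => hrow x z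
  have hone : ∑ x, ∑ z, law (fun ω => (X ω, Z ω)) (x, z) = 1 := by
    rw [← Fintype.sum_prod_type (f := law (fun ω => (X ω, Z ω))), sum_law]
  simp only [sum_add_distrib, ← sum_mul, ← mul_sum, hone] at hsum
  rw [← hβ, ← hν] at hsum
  linarith

end BlockDisjointness

-- Replaying and truncating probing algorithms.

namespace ProbeAlg

variable {A R O : Type}

/-- The output, when the successive probes are answered by the entries of `v`. -/
def run : ProbeAlg A R O → (ℕ → R) → O
  | done o, _ => o
  | probe _ next, v => (next (v 0)).run fun n => v (n + 1)

/-- The sequence of the replies to the probes, continued by `d`. -/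
def replies (reply : A → R) (d : R) : ProbeAlg A R O → ℕ → R
  | done _, _ => d
  | probe a _, 0 => reply a
  | probe a next, n + 1 => (next (reply a)).replies reply d n

/-- The sequence of the probed addresses and the replies, continued by `none`. -/
def transcript (reply : A → R) : ProbeAlg A R O → ℕ → Option (A × R)
  | done _, _ => none
  | probe a _, 0 => some (a, reply a)
  | probe a next, n + 1 => (next (reply a)).transcript reply n

/-- The answer, replaced by `false` if it is not found with `t` probes. -/
def outputWithin (reply : A → R) : ProbeAlg A R Bool → ℕ → Bool
  | done o, _ => o
  | probe _ _, 0 => false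
  | probe a next, t + 1 => (next (reply a)).outputWithin reply t

lemma run_replies (reply : A → R) (d : R) (p : ProbeAlg A R O) :
    p.run (p.replies reply d) = p.output reply := by
  induction p with
  | done o => rfl
  | probe a next ih => exact ih (reply a)

lemma replies_of_numProbes_le (reply : A → R) (d : R) (p : ProbeAlg A R O) {n : ℕ}
    (h : p.numProbes reply ≤ n) : p.replies reply d n = d := by
  induction p generalizing n with
  | done o => rfl
  | probe a next ih =>
    cases n with
    | zero => simp [numProbes] at h
    | succ n => exact ih (reply a) (Nat.le_of_succ_le_succ h)

lemma outputWithin_eq_output (reply : A → R) (p : ProbeAlg A R Bool) {t : ℕ}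
    (h : p.numProbes reply ≤ t) : p.outputWithin reply t = p.output reply := by
  induction p generalizing t with
  | done o => rfl
  | probe a next ih =>
    cases t with
    | zero => simp [numProbes] at h
    | succ t => exact ih (reply a) (Nat.le_of_succ_le_succ h)

/-- Because addresses are recorded, the right side sees the algorithm only through its transcript.
This makes the rectangles independent of the index, the set and the advice. -/
lemma transcript_eq_iff (reply reply' : A → R) (p : ProbeAlg A R O) (t : ℕ) :
    (∀ l < t, p.transcript reply' l = p.transcript reply l) ↔
      ∀ l < t, ∀ a r, p.transcript reply l = some (a, r) → reply' a = r := by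
  induction p generalizing t with
  | done o => simp [transcript]
  | probe a next ih =>
    cases t with
    | zero => simp
    | succ t =>
      rw [Nat.forall_lt_succ_left, Nat.forall_lt_succ_left]
      simp only [transcript, Option.some.injEq, Prod.mk.injEq, true_and]
      constructor
      · rintro ⟨h0, h⟩
        rw [h0] at h
        refine ⟨?_, (ih _ t).1 h⟩
        rintro _ _ ⟨rfl, rfl⟩
        exact h0
      · rintro ⟨h0, h⟩
        have h1 : reply' a = reply a := h0 _ _ ⟨rfl, rfl⟩
        rw [h1]
        exact ⟨rfl, (ih _ t).2 h⟩

lemma outputWithin_congr (reply reply' : A → R) (p : ProbeAlg A R Bool) (t : ℕ)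
    (h : ∀ l < t, p.transcript reply' l = p.transcript reply l) :
    p.outputWithin reply' t = p.outputWithin reply t := by
  induction p generalizing t with
  | done o => rfl
  | probe a next ih =>
    cases t with
    | zero => rfl
    | succ t =>
      rw [Nat.forall_lt_succ_left] at h
      simp only [transcript, Option.some.injEq, Prod.mk.injEq, true_and] at h
      obtain ⟨h0, h⟩ := h
      rw [h0] at h
      simp only [outputWithin, h0]
      exact ih _ t h

end ProbeAlg

-- Encoding the updated cells as a short list.

open Classical in
/-- The partial function with the given list of values. -/
noncomputable def partialFunOfList {A B : Type} {u : ℕ} (f : Fin u → Option (A × B)) (a : A) :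
    Option B :=
  if h : ∃ b l, f l = some (a, b) then some h.choose else none

lemma exists_partialFunOfList_eq {A B : Type} {u : ℕ} (p : A → Option B) (s : Finset A)
    (hs : s.card ≤ u) (hp : ∀ a, a ∉ s → p a = none) :
    ∃ f : Fin u → Option (A × B), partialFunOfList f = p := by
  classical
  have hlen : s.toList.length ≤ u := by simpa using hs
  refine ⟨fun l => (s.toList[(l : ℕ)]?).bind fun a => (p a).map fun b => (a, b), ?_⟩
  have key : ∀ a b, (∃ l : Fin u, ((s.toList[(l : ℕ)]?).bind fun a => (p a).map fun b => (a, b)) =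
      some (a, b)) ↔ p a = some b := fun a b => by
    constructor
    · rintro ⟨l, hl⟩
      rw [Option.bind_eq_some_iff] at hl
      obtain ⟨a', -, h⟩ := hl
      rw [Option.map_eq_some_iff] at h
      obtain ⟨b', h1, h2⟩ := h
      rw [Prod.mk.injEq] at h2
      rw [← h2.1, ← h2.2, h1]
    · intro h
      have ha : a ∈ s.toList := by
        rw [Finset.mem_toList]
        by_contra hcon
        simp [hp a hcon] at h
      obtain ⟨l, hl, hla⟩ := List.getElem_of_mem ha
      refine ⟨⟨l, hl.trans_le hlen⟩, ?_⟩
      simp [List.getElem?_eq_getElem hl, hla, h]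
  funext a
  unfold partialFunOfList
  simp only [key]
  split_ifs with h
  · exact h.choose_spec.symm
  · cases hpa : p a with
    | none => rfl
    | some b => exact absurd ⟨b, hpa⟩ h

-- Block inputs as subsets of the universe.

namespace BlockDisjointness

/-- The set which consists of one element of each of `q` blocks of size `q`. -/
def blockSet {n q : ℕ} (h : q * q ≤ n) (s : Fin q → Fin q) : Finset (Fin n) :=
  Finset.univ.image fun b => Fin.castLE h (finProdFinEquiv (b, s b))

lemma blockSet_inter_eq_empty_iff {n q : ℕ} (h : q * q ≤ n) (s t : Fin q → Fin q) :
    blockSet h s ∩ blockSet h t = ∅ ↔ ∀ b, s b ≠ t b := by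
  rw [← Finset.disjoint_iff_inter_eq_empty, Finset.disjoint_left]
  simp only [blockSet, Finset.mem_image, Finset.mem_univ, true_and, not_exists,
    forall_exists_index, forall_apply_eq_imp_iff, Fin.castLE_inj, EmbeddingLike.apply_eq_iff_eq,
    Prod.mk.injEq, not_and]
  constructor
  · intro H b hb
    exact H b b rfl hb.symm
  · rintro H b _ rfl hb
    exact H _ hb.symm

end BlockDisjointness

-- From a data structure to a protocol.

namespace SemiAdaptiveDS

open Real BlockDisjointness

variable {n k w : ℕ}

/-- A correct data structure cannot have few updated cells and few probes at the same time. -/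
lemma false_of_few_cells {q u t₁ t₂ : ℕ} (D : SemiAdaptiveDS n k w) (hD : D.SolvesMultiphase)
    (hq : 100000 ≤ q) (hqn : q * q ≤ n) (hk : 0 < k) (hw : 1 ≤ w)
    (hu : ∀ S T, (D.updated (D.preprocess S) T).card ≤ u) (ht : D.QueryTimeLE t₁ t₂)
    (huk : 3 * (w : ℝ) * u ≤ k / 100000) (htq : 4 * (w : ℝ) * (t₁ + t₂) ≤ q / 100000) :
    False := by
  classical
  set sets : (Fin k → Fin q → Fin q) → Fin k → Finset (Fin n) := fun S i => blockSet hqn (S i)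
  have hlog2 : log 2 ≤ 1 := by linarith [log_two_lt_d9]
  have hw' : (1 : ℝ) ≤ w := by exact_mod_cast hw
  have h2w : (2 : ℝ) ≤ 2 ^ w := by
    calc (2 : ℝ) = 2 ^ 1 := by norm_num
      _ ≤ 2 ^ w := pow_le_pow_right₀ (by norm_num) hw
  have hcard : Fintype.card (BitVec w) = 2 ^ w := by
    rw [Fintype.card_congr BitVec.equivFin.toEquiv, Fintype.card_fin]
  have h4w : (2 : ℝ) * 2 ≤ 2 ^ w * 2 ^ w := by gcongr
  have hcode : ∀ (S : Fin k → Fin q → Fin q) (T : Fin q → Fin q),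
      ∃ f : Fin u → Option (BitVec w × BitVec w), partialFunOfList f =
        D.deltaReply (D.preprocess (sets S)) (blockSet hqn T) := fun S T =>
    exists_partialFunOfList_eq _ _ (hu (sets S) (blockSet hqn T)) fun a ha => by
      simp [deltaReply, ha]
  choose code hcode using hcode
  -- The second layer as reconstructed from the set and the advice. The padding `0` matches the
  -- default in `replies`.
  let tree (i : Fin k) (x : Fin q → Fin q) (a : Fin t₁ → BitVec w) :
      ProbeAlg (BitVec w) (Option (BitVec w)) Bool :=
    (D.query i (blockSet hqn x)).run fun l => if h : l < t₁ then a ⟨l, h⟩ else 0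
  refine false_of_protocol (A := Fin t₁ → BitVec w) (P := BitVec w → Option (BitVec w))
    (Q := Fin t₂ → Option (BitVec w × Option (BitVec w))) hq hk
    (fun S T => D.deltaReply (D.preprocess (sets S)) (blockSet hqn T)) code partialFunOfList hcode
    (fun i S l => (D.query i (sets S i)).replies (D.preprocess (sets S)) 0 l)
    (fun i x a p l => (tree i x a).transcript p l)
    -- After decoupling, `x`, `a` and `p` need not come from a common run, so the bound `t₂` must be
    -- enforced by truncation.
    (fun i x a p => (tree i x a).outputWithin p t₂)
    (fun σ p => ∀ l a r, σ l = some (a, r) → p a = r) ?_ ?_ ?_ ?_ ?_ ?_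
  · intro i x a p p'
    have := (tree i x a).transcript_eq_iff p p' t₂
    simpa only [funext_iff, Fin.forall_iff] using this
  · intro i x a p p' h
    simp only [funext_iff, Fin.forall_iff] at h
    exact (tree i x a).outputWithin_congr p p' t₂ h
  · intro S T i
    obtain ⟨h1, h2⟩ := ht (sets S) (blockSet hqn T) i
    have htree : tree i (S i) (fun l =>
        (D.query i (sets S i)).replies (D.preprocess (sets S)) 0 l) = D.secondLayer (sets S) i := by
      rw [secondLayer, ← ProbeAlg.run_replies _ 0]
      simp only [tree]
      congr 1
      funext l
      split_ifs with hl
      · rfl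
      · exact (ProbeAlg.replies_of_numProbes_le _ _ _ (h1.trans (not_lt.1 hl))).symm
    simp only [htree]
    rw [ProbeAlg.outputWithin_eq_output _ _ h2, ← blockSet_inter_eq_empty_iff hqn]
    exact hD (sets S) (blockSet hqn T) i
  -- A list entry has `2^(2w) + 1 ≤ 2^(3w)` values.
  · have hc : (Fintype.card (Fin u → Option (BitVec w × BitVec w)) : ℝ) ≤ 2 ^ (3 * w * u) := by
      simp only [Fintype.card_fun, Fintype.card_option, Fintype.card_prod, Fintype.card_fin,
        hcard]
      push_cast
      rw [pow_mul _ (3 * w), mul_comm 3 w, pow_mul]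
      gcongr
      have h5 : (2 ^ w * 2 ^ w : ℝ) * 2 ≤ (2 ^ w * 2 ^ w) * 2 ^ w := by gcongr
      linarith
    refine (log_le_log (by exact_mod_cast Fintype.card_pos) hc).trans ?_
    rw [log_pow]
    push_cast
    calc 3 * (w : ℝ) * u * log 2 ≤ 3 * (w : ℝ) * u * 1 := by gcongr
      _ ≤ _ := by linarith
  · have hc : (Fintype.card (Fin t₁ → BitVec w) : ℝ) = 2 ^ (w * t₁) := by
      simp only [Fintype.card_fun, Fintype.card_fin, hcard]
      push_cast
      rw [pow_mul]
    rw [hc, log_pow]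
    push_cast
    have h0 : (0 : ℝ) ≤ w * t₁ := by positivity
    have h1 : (0 : ℝ) ≤ w * t₂ := by positivity
    calc (w : ℝ) * t₁ * log 2 ≤ w * t₁ * 1 := by gcongr
      _ ≤ _ := by linarith
  -- A transcript entry has `2^w * (2^w + 1) + 1 ≤ 2^(4w)` values.
  · have hc : (Fintype.card (Fin t₂ → Option (BitVec w × Option (BitVec w))) : ℝ) ≤
        2 ^ (4 * w * t₂) := by
      simp only [Fintype.card_fun, Fintype.card_option, Fintype.card_prod, Fintype.card_fin,
        hcard]
      push_cast
      rw [pow_mul _ (4 * w), mul_comm 4 w, pow_mul]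
      gcongr
      have h5 : (2 ^ w * 2 ^ w : ℝ) * 4 ≤ (2 ^ w * 2 ^ w) * (2 ^ w * 2 ^ w) := by gcongr; linarith
      nlinarith
    refine (log_le_log (by exact_mod_cast Fintype.card_pos) hc).trans ?_
    rw [log_pow]
    push_cast
    have h0 : (0 : ℝ) ≤ w * t₁ := by positivity
    calc 4 * (w : ℝ) * t₂ * log 2 ≤ 4 * (w : ℝ) * t₂ * 1 := by gcongr
      _ ≤ _ := by linarith

end SemiAdaptiveDS

theorem mainTheorem2 :
    ∃ c : ℝ, 0 < c ∧ ∀ k : ℕ → ℕ,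
      (fun n : ℕ => (n : ℝ)) =o[atTop] (fun n : ℕ => (k n : ℝ)) →
      ∀ᶠ n : ℕ in atTop, ∀ w : ℕ, 1 ≤ w →
        ∀ D : SemiAdaptiveDS n (k n) w, D.SolvesMultiphase →
          ∀ (tu : ℝ) (t₁ t₂ : ℕ), D.UpdateTimeLE tu → D.QueryTimeLE t₁ t₂ →
            c * ((k n : ℝ) / (w : ℝ)) ≤ (n : ℝ) * tu ∨
            c * (Real.sqrt (n : ℝ) / (w : ℝ)) ≤ ((t₁ + t₂ : ℕ) : ℝ) := by
  -- A tenth of `1 / 100000`, which absorbs the factors 3 and 4 from the encodings and the rounding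
  -- of `√n`.
  refine ⟨1 / 1000000, by norm_num, fun k _ => ?_⟩
  filter_upwards [eventually_ge_atTop (100000 * 100000)] with n hn w hw D hD tu t₁ t₂ htu ht
  by_contra! hcon
  obtain ⟨h1, h2⟩ := hcon
  have hw' : (0 : ℝ) < w := by exact_mod_cast hw
  -- For `k n = 0` the negated bound would make the number of written cells negative.
  have hk : 0 < k n := by
    rw [Nat.pos_iff_ne_zero]
    intro h0
    have := htu (fun _ => ∅) ∅
    rw [h0] at h1
    simp only [Nat.cast_zero, zero_div, mul_zero] at h1
    linarith [(Nat.cast_nonneg _ : (0 : ℝ) ≤ ((D.updated (D.preprocess fun _ => ∅) ∅).card : ℝ))]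
  have hq : 100000 ≤ Nat.sqrt n := Nat.le_sqrt.2 hn
  have hx0 : (0 : ℝ) ≤ 1 / 1000000 * ((k n : ℝ) / w) := by positivity
  refine D.false_of_few_cells (q := Nat.sqrt n) (u := ⌊(1 / 1000000 * ((k n : ℝ) / w) : ℝ)⌋₊)
    hD hq (Nat.sqrt_le n) hk hw (fun S T => Nat.le_floor ((htu S T).trans h1.le)) ht ?_ ?_
  · have h3 := Nat.floor_le hx0
    calc 3 * (w : ℝ) * ⌊(1 / 1000000 * ((k n : ℝ) / w) : ℝ)⌋₊
        ≤ 3 * (w : ℝ) * (1 / 1000000 * ((k n : ℝ) / w)) := by gcongr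
      _ = 3 / 1000000 * k n := by field_simp
      _ ≤ _ := by linarith [(Nat.cast_nonneg (k n) : (0 : ℝ) ≤ k n)]
  · have h3 : √(n : ℝ) ≤ Nat.sqrt n + 1 := Real.real_sqrt_le_nat_sqrt_succ
    have h4 : (100000 : ℝ) ≤ Nat.sqrt n := by exact_mod_cast hq
    push_cast at h2
    calc 4 * (w : ℝ) * (t₁ + t₂) ≤ 4 * (w : ℝ) * (1 / 1000000 * (√(n : ℝ) / w)) := by gcongr
      _ = 4 / 1000000 * √(n : ℝ) := by field_simp
      _ ≤ _ := by linarith
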